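/- Let $\sigma\in(0,2)$, $m\ge 1$, $X,Y,T>0$, $a\in\mathbb R$, $\Omega=(-X,X)\times(0,Y)$, $\Gamma_d=[-X,X]\times\{0\}$, $\Gamma_h=\partial\Omega\setminus\Gamma_d$, $L_\sigma v=\nabla\cdot(y^{1-\sigma}\nabla v)$, $\mu_\sigma=2^{\sigma-1}\Gamma(\sigma/2)/\Gamma(1-\sigma/2)$, $\nu_\sigma=\sigma\mu_\sigma$ and $\frac{\partial v}{\partial y^\sigma}(x,0)=\mu_\sigma\lim_{y\to0^+}y^{1-\sigma}\frac{\partial v}{\partial y}(x,y)$. Let $f\ge 0$ on $[-X,X]$, and let $w\ge0$, continuous on $\overline\Omega\times[0,T]$ and $C^2$ in $(x,y)\in\Omega$ for $t\in(0,T]$, be a classical solution of $$L_\sigma w=0 \text{ in }\Omega\times(0,T],\qquad \frac{\partial w^{1/m}}{\partial t}=\frac{\partial w}{\partial y^\sigma}\text{ on }\Gamma_d\times(0,T],\qquad w(x,0,0)=f(x)^m,\qquad w=0\text{ on }\Gamma_h\times[0,T].$$ Put $u=w^{1/m}$ and suppose that $w$ has the following regularity: $t\mapsto u(x,0,t)$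 is $C^2$ on $[0,T]$ with $\partial_t^2u(x,0,t)$ bounded uniformly in $x\in[-X,X]$; $\partial_x^2 w$ is bounded on $\Omega\times(0,T]$; and, with $\varphi(u)=u^m$, there is a constant $R$ with $|\varphi'(u(x,y,t))-\varphi'(u(x,0,t))|\le R\,y^\sigma$ for $x\in(-X,X)$, $y\in(0,Y]$, $t\in(0,T]$ (which is void for $m=1$). For integers $I,K,J\ge1$ with $2X/I=Y/K$ let $\Delta x=2X/I$, $\Delta t=T/J$, $x_i=i\Delta x-X$, $y_k=k\Delta x$, $t_j=j\Delta t$. Let $L^D_\sigma$ be a family of linear operators, one on the functions on the nodes $(i,k)$, $0\le i\le I$, $0\le k\le K$, of each of these meshes, which (i) has order $a$: for every $v$ in a class $\mathcal R$ of functions $v(x,y,t)$ that contains all time-independent $v\in C^\infty(\mathbb R^2)$ and the solution $w$, there is $C_v$ such that $|L^D_\sigma v_i^k-L_\sigma v(x_i,y_k,t)|\le C_v\,\Delta x^a$ for all meshes, all $0<i<I$, $0<k<K$ and all $t\in(0,T]$; (ii) satisfies the discrete maximum principle: if $L^D_\sigma V\ge0$ at all interior nodes, then $V$ attains its maximum at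 a boundary node. Let $(W_j)_i^k$, $0\le j\le J$, solve the scheme $$L^D_\sigma[(W_j)_i^k]=0\quad(0<i<I,\ 0<k<K),\qquad (W_j)_i^k=0\text{ if } i\in\{0,I\}\text{ or }k=K,$$ $$(W_0)_i^0=f(x_i)^m,\qquad (W_j)_i^0=\Big[\nu_\sigma\tfrac{\Delta t}{\Delta x^\sigma}\big((W_{j-1})_i^1-(W_{j-1})_i^0\big)+[(W_{j-1})_i^0]^{1/m}\Big]^m\quad(0<i<I,\ 1\le j\le J),$$ and assume $\Delta t\le C(m,f)\,\Delta x^\sigma$ with $C(m,f)=[m\|f\|_{L^\infty(-X,X)}^{m-1}\nu_\sigma]^{-1}$ ($=\infty$ if the bracket vanishes). Then $F_j=\max_{i,k}|w(x_i,y_k,t_j)-(W_j)_i^k|$ satisfies $$F_j\le C\Big(\Delta t+\Delta x^{2-\sigma}+\frac{\Delta x^a}{\Delta t}\Big),\qquad 0\le j\le J,$$ with a constant $C$ that does not depend on the mesh, on $W$ or on $j$. Consequently, along every sequence of such meshes with $\Delta x,\Delta t\to0$ and $\Delta x^a/\Delta t\to0$, the numerical solutions converge to $w$: $\max_{0\le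 j\le J}F_j\to0$. -/

import Mathlib

open Set Filter Topology
open scoped ContDiff

namespace FracPME

noncomputable section

/-! ### The continuous problem on `Ω = (-X, X) × (0, Y)` -/

/-- The constant `μ_σ = 2^(σ-1) Γ(σ/2) / Γ(1-σ/2)`. -/
def mu (σ : ℝ) : ℝ := 2 ^ (σ - 1) * Real.Gamma (σ / 2) / Real.Gamma (1 - σ / 2)

/-- The constant `ν_σ = σ μ_σ`. -/
def nu (σ : ℝ) : ℝ := σ * mu σ

/-- The operator `L_σ v = ∇ · (y^(1-σ) ∇ v)` in the variables `(x, y)`. -/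
def Lsig (σ : ℝ) (v : ℝ → ℝ → ℝ) (x y : ℝ) : ℝ :=
  deriv (fun s => y ^ (1 - σ) * deriv (fun r => v r y) s) x
    + deriv (fun s => s ^ (1 - σ) * deriv (fun r => v x r) s) y

/-- `q` is the normalized `σ`-derivative `∂v/∂y^σ (x, 0) = μ_σ lim_{y → 0+} y^(1-σ) ∂v/∂y (x, y)`. -/
def HasSigmaDeriv (σ : ℝ) (v : ℝ → ℝ → ℝ) (x q : ℝ) : Prop :=
  Tendsto (fun y => mu σ * (y ^ (1 - σ) * deriv (fun r => v x r) y)) (𝓝[>] 0) (𝓝 q)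

/-- Nonnegative classical solutions `w (x, y, t)` of the extension problem in the rectangle. -/
structure IsClassicalSolution (σ m X Y T : ℝ) (f : ℝ → ℝ) (w : ℝ → ℝ → ℝ → ℝ) : Prop where
  continuousOn : ContinuousOn (fun p : ℝ × ℝ × ℝ => w p.1 p.2.1 p.2.2)
    (Icc (-X) X ×ˢ Icc 0 Y ×ˢ Icc 0 T)
  nonneg : ∀ x ∈ Icc (-X) X, ∀ y ∈ Icc 0 Y, ∀ t ∈ Icc 0 T, 0 ≤ w x y t
  contDiffOn : ∀ t ∈ Ioc 0 T,
    ContDiffOn ℝ 2 (fun p : ℝ × ℝ => w p.1 p.2 t) (Ioo (-X) X ×ˢ Ioo 0 Y)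
  equation : ∀ t ∈ Ioc 0 T, ∀ x ∈ Ioo (-X) X, ∀ y ∈ Ioo 0 Y,
    Lsig σ (fun x y => w x y t) x y = 0
  base : ∀ t ∈ Ioc 0 T, ∀ x ∈ Icc (-X) X, ∃ q : ℝ,
    HasSigmaDeriv σ (fun x y => w x y t) x q ∧
      HasDerivWithinAt (fun s => w x 0 s ^ (1 / m)) q (Icc 0 T) t
  initial : ∀ x ∈ Icc (-X) X, w x 0 0 = f x ^ m
  lateral : ∀ t ∈ Icc 0 T, ∀ x ∈ Icc (-X) X, ∀ y ∈ Ioc 0 Y,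
    (x = -X ∨ x = X ∨ y = Y) → w x y t = 0

/-- The regularity of the exact solution: `u = w^(1/m)` is `C²` in `t` on the base, `w = u^m` has
a bounded second derivative in `x`, and `φ'(u) = m u^(m-1)` satisfies
`|φ'(u(x,y,t)) - φ'(u(x,0,t))| ≤ R y^σ`. -/
structure IsRegularSolution (σ m X Y T : ℝ) (w : ℝ → ℝ → ℝ → ℝ) : Prop where
  time : ∀ x ∈ Icc (-X) X, ContDiffOn ℝ 2 (fun t => w x 0 t ^ (1 / m)) (Icc 0 T)
  time_bound : ∃ M : ℝ, ∀ x ∈ Icc (-X) X, ∀ t ∈ Icc 0 T,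
    |iteratedDerivWithin 2 (fun s => w x 0 s ^ (1 / m)) (Icc 0 T) t| ≤ M
  space_bound : ∃ M : ℝ, ∀ t ∈ Ioc 0 T, ∀ x ∈ Ioo (-X) X, ∀ y ∈ Ioo 0 Y,
    |iteratedDeriv 2 (fun s => w s y t) x| ≤ M
  base_bound : ∃ R : ℝ, ∀ t ∈ Ioc 0 T, ∀ x ∈ Ioo (-X) X, ∀ y ∈ Ioc 0 Y,
    |m * (w x y t ^ (1 / m)) ^ (m - 1) - m * (w x 0 t ^ (1 / m)) ^ (m - 1)| ≤ R * y ^ σ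

/-! ### Meshes and discretizations -/

/-- `I` and `K` space steps, with `Δx = 2X/I = Y/K = Δy`, and `J` time steps. -/
structure Mesh (X Y T : ℝ) where
  I : ℕ
  K : ℕ
  J : ℕ
  I_pos : 0 < I
  K_pos : 0 < K
  J_pos : 0 < J
  square : 2 * X / (I : ℝ) = Y / (K : ℝ)

namespace Mesh

variable {X Y T : ℝ}

def dx (M : Mesh X Y T) : ℝ := 2 * X / (M.I : ℝ)

def dt (M : Mesh X Y T) : ℝ := T / (M.J : ℝ)

/-- The node `x_i = i Δx - X`. -/
def x (M : Mesh X Y T) (i : ℕ) : ℝ := (i : ℝ) * M.dx - X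

/-- The node `y_k = k Δy = k Δx`. -/
def y (M : Mesh X Y T) (k : ℕ) : ℝ := (k : ℝ) * M.dx

/-- The time `t_j = j Δt`. -/
def t (M : Mesh X Y T) (j : ℕ) : ℝ := (j : ℝ) * M.dt

end Mesh

/-- Functions on the space nodes `(i, k)`, `0 ≤ i ≤ I`, `0 ≤ k ≤ K`. -/
abbrev GridFun (I K : ℕ) : Type := Fin (I + 1) × Fin (K + 1) → ℝ

def toGrid (I K : ℕ) (V : ℕ → ℕ → ℝ) : GridFun I K := fun p => V (p.1 : ℕ) (p.2 : ℕ)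

def IsInteriorNode {I K : ℕ} (p : Fin (I + 1) × Fin (K + 1)) : Prop :=
  (0 < (p.1 : ℕ) ∧ (p.1 : ℕ) < I) ∧ (0 < (p.2 : ℕ) ∧ (p.2 : ℕ) < K)

/-- A linear discrete operator on each space mesh; only its values at interior nodes are used. -/
abbrev Discretization : Type := (I K : ℕ) → (GridFun I K →ₗ[ℝ] GridFun I K)

/-- `D` approximates `L_σ` with order `a` on a class `𝓡` of functions `v (x, y, t)`, with a constant
that depends on `v`, but not on the mesh, the node or the time. -/
def HasOrder (σ X Y T : ℝ) (D : Discretization) (a : ℝ) (𝓡 : Set (ℝ → ℝ → ℝ → ℝ)) : Prop :=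
  ∀ v ∈ 𝓡, ∃ C : ℝ, ∀ M : Mesh X Y T, ∀ t ∈ Ioc 0 T,
    ∀ p : Fin (M.I + 1) × Fin (M.K + 1), IsInteriorNode p →
      |D M.I M.K (toGrid M.I M.K fun i k => v (M.x i) (M.y k) t) p
          - Lsig σ (fun x y => v x y t) (M.x p.1) (M.y p.2)| ≤ C * M.dx ^ a

/-- The discrete maximum principle: a grid function with `D V ≥ 0` at the interior nodes attains its
maximum at a boundary node. -/
def HasMaxPrinciple (X Y T : ℝ) (D : Discretization) : Prop :=
  ∀ (M : Mesh X Y T) (V : GridFun M.I M.K),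
    (∀ p, IsInteriorNode p → 0 ≤ D M.I M.K V p) →
      ∀ p, ∃ b, ¬ IsInteriorNode b ∧ V p ≤ V b

/-! ### The numerical method -/

/-- `W j i k` solves the numerical scheme on the mesh `M`. -/
structure IsNumericalSolution (σ m : ℝ) {X Y T : ℝ} (f : ℝ → ℝ) (D : Discretization)
    (M : Mesh X Y T) (W : ℕ → ℕ → ℕ → ℝ) : Prop where
  interior : ∀ j ≤ M.J, ∀ p : Fin (M.I + 1) × Fin (M.K + 1), IsInteriorNode p →
    D M.I M.K (toGrid M.I M.K (W j)) p = 0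
  init : ∀ i, 0 < i → i < M.I → W 0 i 0 = f (M.x i) ^ m
  step : ∀ j < M.J, ∀ i, 0 < i → i < M.I →
    W (j + 1) i 0
      = (nu σ * (M.dt / M.dx ^ σ) * (W j i 1 - W j i 0) + W j i 0 ^ (1 / m)) ^ m
  lateral : ∀ j ≤ M.J, ∀ i ≤ M.I, ∀ k ≤ M.K, (i = 0 ∨ i = M.I ∨ k = M.K) → W j i k = 0

/-- `‖f‖_∞` on `[-X, X]`, for nonnegative `f`. -/
def supNorm (X : ℝ) (f : ℝ → ℝ) : ℝ := sSup (f '' Icc (-X) X)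

/-- The restriction `Δt ≤ C(m,f) Δx^σ` with `C(m,f) = [m ‖f‖_∞^(m-1) ν_σ]⁻¹`, multiplied out so
that `C(m,f) = ∞` when the bracket vanishes. -/
def CFL (σ m : ℝ) {X Y T : ℝ} (f : ℝ → ℝ) (M : Mesh X Y T) : Prop :=
  m * supNorm X f ^ (m - 1) * nu σ * M.dt ≤ M.dx ^ σ

/-- `F_j = max_{i,k} |w(x_i, y_k, t_j) - (W_j)_i^k|`. -/
def errF {X Y T : ℝ} (w : ℝ → ℝ → ℝ → ℝ) (M : Mesh X Y T) (W : ℕ → ℕ → ℕ → ℝ) (j : ℕ) : ℝ :=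
  (Finset.univ : Finset (Fin (M.I + 1) × Fin (M.K + 1))).sup' Finset.univ_nonempty
    fun p => |w (M.x p.1) (M.y p.2) (M.t j) - W j p.1 p.2|

/-- `max_{0 ≤ j ≤ J} F_j`. -/
def maxErr {X Y T : ℝ} (w : ℝ → ℝ → ℝ → ℝ) (M : Mesh X Y T) (W : ℕ → ℕ → ℕ → ℝ) : ℝ :=
  (Finset.range (M.J + 1)).sup' Finset.nonempty_range_add_one fun j => errF w M W j

end

end FracPME

/-! The scheme is monotone. With U = W^(1/m) on the base and Λ = ν_σ Δt/Δx^σ, one step reads U' = (U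
- Λ U^m) + Λ W₁, and the CFL condition makes s ↦ s - Λ s^m nondecreasing on [0, B], where B bounds
f. With the discrete maximum principle this gives stability, 0 ≤ U ≤ B
(`IsNumericalSolution.stable`), and it allows the error to be trapped between barriers built from
the exact solution.

The difficulty is the degeneracy: the time step acts on u, the elliptic extension on w = u^m. The
barriers are (u - c)₊ from below and N + c from above, with N = (u^m + c^m)^(1/m). Their m-th powers
are respectively a convex and a concave function of w. A tangent line of such a function is affine
in w, hence discretely harmonic up to O(Δx^a); the maximum principle carries the ordering from the
base to the node of tangency, where line and barrier agree (`sub_comparison`, `super_comparison`).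
Using N instead of u keeps the upper slopes at most 2^(m-1), since N ≥ c.

In one time step these slopes differ from 1 by O((m-1)c/u), or O((m-1)c/N), and multiply Δt ∂ₜu. The
loss is only O(c Δt), because (m-1)|∂ₜu| ≤ Q u on the base (`exists_baseQ_le_baseU`): w(y) - w(0)
behaves like ∂ₜu y^σ/ν_σ, while (m-1)|w(y) - w(0)| is at most max(u(y), u(0)) times the increment of
φ'(u), which is O(y^σ).

The remaining losses per step are Δt² from Taylor's formula, Δt Δx^(2-σ) from the expansion of w at
the base (`flux_expansion`), and Λ O(Δx^a) from the extension, where Λ is bounded by CFL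
(`exists_super_step`, `exists_sub_step`). All are absorbed by c_j = η (1 + 2AΔt)^j with η = Δt +
Δx^(2-σ) + Δx^a/Δt, and c_j ≤ η exp(2AT). Lipschitz continuity of s^m on bounded sets turns this
into the estimate on the base, and one more comparison extends it to all nodes. If f = 0 and m > 1
the CFL condition is void; then W vanishes, and u vanishes on the base by Grönwall applied to
(m-1)|∂ₜu| ≤ Q u. -/

namespace FracPME

/-! ### Convexity inequalities for powers -/

/-- The convex function `s ^ m` lies above its tangent lines. -/
lemma rpow_tangent_le {m a b : ℝ} (hm : 1 ≤ m) (ha : 0 ≤ a) (hb : 0 ≤ b) :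
    a ^ m + m * a ^ (m - 1) * (b - a) ≤ b ^ m := by
  rcases ha.eq_or_lt with rfl | ha
  · rw [Real.zero_rpow (by linarith)]
    rcases hm.eq_or_lt with rfl | hm
    · simp
    · rw [Real.zero_rpow (by linarith)]
      simpa using Real.rpow_nonneg hb m
  · have h := one_add_mul_self_le_rpow_one_add (s := b / a - 1)
      (by have := div_nonneg hb ha.le; linarith) hm
    have h1 : b ^ m = a ^ m * (1 + (b / a - 1)) ^ m := by
      rw [← Real.mul_rpow ha.le (by have := div_nonneg hb ha.le; linarith)]
      congr 1
      field_simp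
      ring
    have h2 : a ^ m = a ^ (m - 1) * a := by
      rw [← Real.rpow_add_one ha.ne']; congr 1; ring
    rw [h1]
    calc a ^ m + m * a ^ (m - 1) * (b - a) = a ^ m * (1 + m * (b / a - 1)) := by
          rw [h2]; field_simp
      _ ≤ _ := mul_le_mul_of_nonneg_left h (Real.rpow_nonneg ha.le m)

/-- The map `z ^ m ↦ (z + c) ^ m` is concave: it lies below its tangent lines. -/
lemma add_rpow_le_tangent {m c z₀ z₁ : ℝ} (hm : 1 ≤ m) (hc : 0 ≤ c) (hz₀ : 0 < z₀)
    (hz₁ : 0 ≤ z₁) :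
    (z₁ + c) ^ m ≤ (z₀ + c) ^ m + ((z₀ + c) / z₀) ^ (m - 1) * (z₁ ^ m - z₀ ^ m) := by
  have hs : 0 < z₀ + c := by linarith
  -- With λ = z₀/(z₀ + c), the point z₁ + c is the convex combination λ (z₁/λ) + (1 - λ)(z₀ + c).
  -- Jensen's inequality for s^m there is the claim, with equality at z₁ = z₀.
  have h := (convexOn_rpow hm).2 (show z₁ * ((z₀ + c) / z₀) ∈ Ici 0 from mem_Ici.2 (by positivity))
    (show z₀ + c ∈ Ici 0 from hs.le) (show 0 ≤ z₀ / (z₀ + c) by positivity)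
    (show 0 ≤ c / (z₀ + c) by positivity) (by field_simp)
  simp only [smul_eq_mul] at h
  have e1 : z₀ / (z₀ + c) * (z₁ * ((z₀ + c) / z₀)) + c / (z₀ + c) * (z₀ + c) = z₁ + c := by
    field_simp
  have e2 : ((z₀ + c) / z₀) ^ m = ((z₀ + c) / z₀) ^ (m - 1) * ((z₀ + c) / z₀) := by
    rw [← Real.rpow_add_one (by positivity)]; congr 1; ring
  have e3 : (z₀ + c) ^ m = ((z₀ + c) / z₀) ^ (m - 1) * z₀ ^ m * ((z₀ + c) / z₀) := by
    rw [mul_right_comm, ← e2, ← Real.mul_rpow (by positivity) hz₀.le]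
    congr 1; field_simp
  rw [e1, Real.mul_rpow hz₁ (by positivity), e2, e3] at h
  rw [e3]
  refine h.trans (le_of_eq ?_)
  field_simp
  ring

/-- The map `z ^ m ↦ (z - c)₊ ^ m` is convex: it lies above its tangent lines. -/
lemma tangent_le_sub_rpow {m c z₀ z₁ : ℝ} (hm : 1 ≤ m) (hc : 0 ≤ c) (hz₀ : c < z₀)
    (hz₁ : 0 ≤ z₁) :
    (z₀ - c) ^ m + (1 - c / z₀) ^ (m - 1) * (z₁ ^ m - z₀ ^ m) ≤ (max (z₁ - c) 0) ^ m := by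
  have hp : 0 < z₀ := by linarith
  have hq : 0 < z₀ - c := by linarith
  -- Subtracting c inverts adding c, and the inverse of an increasing concave map is convex; the two
  -- slopes are reciprocal.
  have h := add_rpow_le_tangent hm hc hq (le_max_right (z₁ - c) 0)
  rw [sub_add_cancel] at h
  have h1 : z₁ ^ m ≤ (max (z₁ - c) 0 + c) ^ m :=
    Real.rpow_le_rpow hz₁ (by linarith [le_max_left (z₁ - c) 0]) (by linarith)
  have e : (1 - c / z₀) ^ (m - 1) * (z₀ / (z₀ - c)) ^ (m - 1) = 1 := by
    have : 1 - c / z₀ = (z₀ - c) / z₀ := by field_simp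
    rw [this, ← Real.mul_rpow (by positivity) (by positivity)]
    have : (z₀ - c) / z₀ * (z₀ / (z₀ - c)) = 1 := by field_simp
    rw [this, Real.one_rpow]
  have hβ : 0 ≤ (1 - c / z₀) ^ (m - 1) :=
    Real.rpow_nonneg (by rw [sub_nonneg, div_le_one hp]; exact hz₀.le) _
  have h2 := mul_le_mul_of_nonneg_left (h1.trans h) hβ
  rw [mul_add, ← mul_assoc, e] at h2
  linarith

/-- The powers `(1 ± r) ^ (m - 1)` differ from `1` by `O((m - 1) r)`. -/
lemma exists_rpow_sub_one_bound {m : ℝ} (hm : 1 ≤ m) :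
    ∃ K : ℝ, 0 ≤ K ∧ ∀ r ∈ Icc (0 : ℝ) 1, (1 + r) ^ (m - 1) - 1 ≤ K * ((m - 1) * r) ∧
      1 - (1 - r) ^ (m - 1) ≤ K * ((m - 1) * r) := by
  rcases hm.eq_or_lt with rfl | hm'
  · exact ⟨0, le_rfl, fun r _ => by simp⟩
  -- The factor m - 1 stays outside the constant so that it can later be paired with |∂ₜu|: only (m
  -- - 1)|∂ₜu| is controlled by u.
  refine ⟨m * 2 ^ (m - 1) / (m - 1), div_nonneg (by positivity) (by linarith), fun r hr => ?_⟩
  obtain ⟨h0, h1⟩ := hr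
  have hK : m * 2 ^ (m - 1) / (m - 1) * ((m - 1) * r) = m * 2 ^ (m - 1) * r := by
    have : m - 1 ≠ 0 := by linarith
    field_simp
  rw [hK]
  have h2 : (1 : ℝ) ≤ 2 ^ (m - 1) := Real.one_le_rpow (by norm_num) (by linarith)
  constructor
  · have a1 : (1 + r) ^ (m - 1) ≤ (1 + r) ^ m :=
      Real.rpow_le_rpow_of_exponent_le (by linarith) (by linarith)
    have a2 := rpow_tangent_le hm (a := 1 + r) (b := 1) (by linarith) (by norm_num)
    have a3 : (1 + r) ^ (m - 1) ≤ 2 ^ (m - 1) :=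
      Real.rpow_le_rpow (by linarith) (by linarith) (by linarith)
    have a4 : m * (1 + r) ^ (m - 1) * r ≤ m * 2 ^ (m - 1) * r := by gcongr
    rw [Real.one_rpow] at a2
    nlinarith
  · have a1 : (1 - r) ^ m ≤ (1 - r) ^ (m - 1) := by
      rcases h1.eq_or_lt with rfl | h1
      · rw [sub_self, Real.zero_rpow (by linarith)]; positivity
      · exact Real.rpow_le_rpow_of_exponent_ge (by linarith) (by linarith) (by linarith)
    have a2 := rpow_tangent_le hm (a := 1) (b := 1 - r) (by norm_num) (by linarith)
    rw [Real.one_rpow, Real.one_rpow] at a2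
    have a4 : m * 1 * r ≤ m * 2 ^ (m - 1) * r := by gcongr
    linarith

/-- `(m - 1) |b ^ m - a ^ m| ≤ m max(a, b) |b ^ (m - 1) - a ^ (m - 1)|`. -/
lemma abs_rpow_sub_rpow_le {m a b : ℝ} (hm : 1 ≤ m) (ha : 0 ≤ a) (hb : 0 ≤ b) :
    (m - 1) * |b ^ m - a ^ m| ≤ max a b * |m * b ^ (m - 1) - m * a ^ (m - 1)| := by
  rcases hm.eq_or_lt with rfl | hm'
  · simp
  wlog hab : a ≤ b generalizing a b
  · rw [abs_sub_comm, max_comm, abs_sub_comm (m * _)]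
    exact this hb ha (le_of_not_ge hab)
  have key : ∀ {z : ℝ}, 0 ≤ z → z ^ (m - 1) * z = z ^ m := by
    intro z hz
    rcases hz.eq_or_lt with rfl | hz
    · rw [Real.zero_rpow (by linarith : m ≠ 0), mul_zero]
    · rw [← Real.rpow_add_one hz.ne']; congr 1; ring
  have h1 : a ^ m ≤ b ^ m := Real.rpow_le_rpow ha hab (by linarith)
  have h2 : a ^ (m - 1) ≤ b ^ (m - 1) := Real.rpow_le_rpow ha hab (by linarith)
  rw [max_eq_right hab, abs_of_nonneg (by linarith), abs_of_nonneg (by nlinarith)]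
  -- This is Young's inequality m a^(m-1) b ≤ (m-1) a^m + b^m.
  have h3 := rpow_tangent_le hm ha hb
  have h4 := key ha
  have h5 := key hb
  nlinarith

/-- Lipschitz continuity of `s ^ m` on `[0, S]`. -/
lemma abs_rpow_sub_rpow_le_of_le {m a b S : ℝ} (hm : 1 ≤ m) (ha : 0 ≤ a) (hb : 0 ≤ b)
    (haS : a ≤ S) (hbS : b ≤ S) : |a ^ m - b ^ m| ≤ m * S ^ (m - 1) * |a - b| := by
  wlog hab : b ≤ a generalizing a b
  · rw [abs_sub_comm, abs_sub_comm a]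
    exact this hb ha hbS haS (le_of_not_ge hab)
  have h1 : b ^ m ≤ a ^ m := Real.rpow_le_rpow hb hab (by linarith)
  rw [abs_of_nonneg (by linarith), abs_of_nonneg (by linarith)]
  have h3 := rpow_tangent_le hm ha hb
  have h4 : a ^ (m - 1) ≤ S ^ (m - 1) := Real.rpow_le_rpow ha haS (by linarith)
  have h5 : m * a ^ (m - 1) * (a - b) ≤ m * S ^ (m - 1) * (a - b) := by
    have : 0 ≤ a - b := by linarith
    gcongr
  linarith

lemma le_of_rpow_le_rpow {m a b : ℝ} (hm : 1 ≤ m) (ha : 0 ≤ a) (hb : 0 ≤ b)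
    (h : a ^ m ≤ b ^ m) : a ≤ b :=
  (Real.rpow_le_rpow_iff ha hb (by linarith)).1 h

/-- Convexity of the `ℓ^m` norm of `(u, c)` as a function of `u`. -/
lemma lpNorm_tangent_le {m c u u' N N' : ℝ} (hm : 1 ≤ m) (hc : 0 ≤ c) (hu : 0 ≤ u)
    (hu' : 0 ≤ u') (hN : 0 < N) (hN' : 0 ≤ N') (hNe : N ^ m = u ^ m + c ^ m)
    (hNe' : N' ^ m = u' ^ m + c ^ m) :
    (u / N) ^ (m - 1) * (u' - u) ≤ N' - N := by
  have hm0 : 0 < m := by linarith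
  rcases hN'.eq_or_lt with rfl | hN'
  · rw [Real.zero_rpow hm0.ne'] at hNe'
    have h1 := Real.rpow_nonneg hu' m
    have h2 := Real.rpow_nonneg hc m
    have hu0 : u' = 0 := by
      by_contra h
      have := Real.rpow_pos_of_pos (lt_of_le_of_ne hu' (Ne.symm h)) m
      linarith
    have hc0 : c ^ m = 0 := by linarith
    have hNu : N ≤ u := le_of_rpow_le_rpow hm hN.le hu (by linarith)
    have huN : u ≤ N := le_of_rpow_le_rpow hm hu hN.le (by linarith)
    have : u = N := le_antisymm huN hNu
    subst this
    rw [div_self hN.ne', Real.one_rpow, hu0, one_mul]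
  -- The pair (α, γ) below is the dual vector of (u, c)/N on the unit sphere of ℓ^m. Adding the two
  -- tangent inequalities gives Hölder's α u' + γ c ≤ N', and equality holds at (u, c).
  have h1 := rpow_tangent_le hm (a := u / N) (b := u' / N') (by positivity) (by positivity)
  have h2 := rpow_tangent_le hm (a := c / N) (b := c / N') (by positivity) (by positivity)
  have key : ∀ {z : ℝ}, 0 ≤ z → z ^ (m - 1) * z = z ^ m := by
    intro z hz
    rcases hz.eq_or_lt with rfl | hz
    · rw [Real.zero_rpow (by linarith : m ≠ 0), mul_zero]
    · rw [← Real.rpow_add_one hz.ne']; congr 1; ring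
  have k1 := key (z := u / N) (by positivity)
  have k2 := key (z := c / N) (by positivity)
  have s1 : (u / N) ^ m + (c / N) ^ m = 1 := by
    rw [Real.div_rpow hu hN.le, Real.div_rpow hc hN.le, ← add_div, ← hNe,
      div_self (Real.rpow_pos_of_pos hN m).ne']
  have s2 : (u' / N') ^ m + (c / N') ^ m = 1 := by
    rw [Real.div_rpow hu' hN'.le, Real.div_rpow hc hN'.le, ← add_div, ← hNe',
      div_self (Real.rpow_pos_of_pos hN' m).ne']
  set α := (u / N) ^ (m - 1)
  set γ := (c / N) ^ (m - 1)
  have t : m * (α * (u' / N') + γ * (c / N')) ≤ m * 1 := by nlinarith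
  have t' : α * (u' / N') + γ * (c / N') ≤ 1 := le_of_mul_le_mul_left t hm0
  have t1 : α * u' + γ * c ≤ N' := by
    have := mul_le_mul_of_nonneg_right t' hN'.le
    have e : (α * (u' / N') + γ * (c / N')) * N' = α * u' + γ * c := by field_simp
    linarith
  have t2 : α * u + γ * c = N := by
    have : (α * (u / N) + γ * (c / N)) * N = 1 * N := by rw [k1, k2, s1]
    have e : (α * (u / N) + γ * (c / N)) * N = α * u + γ * c := by field_simp
    linarith
  linarith

/-! ### One explicit step: monotonicity and barriers -/

/-- Monotonicity of the explicit step `s ↦ s - Λ s ^ m` on `[0, B]`. -/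
lemma step_mono {m Λ B U v : ℝ} (hm : 1 ≤ m) (hΛ : 0 ≤ Λ) (hcfl : Λ * (m * B ^ (m - 1)) ≤ 1)
    (hU : 0 ≤ U) (hUv : U ≤ v) (hv : v ≤ B) : U - Λ * U ^ m ≤ v - Λ * v ^ m := by
  have h1 := rpow_tangent_le hm (hU.trans hUv) hU
  have h2 : v ^ (m - 1) ≤ B ^ (m - 1) := Real.rpow_le_rpow (hU.trans hUv) hv (by linarith)
  have h3 : Λ * (m * v ^ (m - 1)) ≤ 1 := le_trans (by gcongr) hcfl
  have h4 : Λ * (m * v ^ (m - 1)) * (v - U) ≤ 1 * (v - U) :=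
    mul_le_mul_of_nonneg_right h3 (by linarith)
  nlinarith [mul_le_mul_of_nonneg_left h1 hΛ]

/-- Monotonicity of the explicit step up to `O(Δt²)`, slightly beyond `B`. -/
lemma step_mono_beyond {m Λ B U v S dt T : ℝ} (hm : 1 ≤ m) (hΛ : 0 ≤ Λ) (hB : 0 < B)
    (hcfl : Λ * (m * B ^ (m - 1)) ≤ 1) (hU : 0 ≤ U) (hUB : U ≤ B) (hUv : U ≤ v) (hS : 0 ≤ S)
    (hdt : 0 ≤ dt) (hdtT : dt ≤ T) (hv : v ≤ B + S * dt) :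
    U - Λ * U ^ m ≤ v - Λ * v ^ m + m * (1 + S * T / B) ^ (m - 1) / B * S ^ 2 * dt ^ 2 := by
  have hT : 0 ≤ T := hdt.trans hdtT
  rcases le_or_gt v B with hvB | hvB
  · have := step_mono hm hΛ hcfl hU hUv hvB
    have : 0 ≤ m * (1 + S * T / B) ^ (m - 1) / B * S ^ 2 * dt ^ 2 := by positivity
    linarith
  -- Monotonicity reaches up to B. From B to v the function s - Λ s^m may decrease, but with slope
  -- at least -P r, r = (v - B)/B; as v - B ≤ S dt, the loss is quadratic in dt.
  refine (step_mono hm hΛ hcfl hU hUB le_rfl).trans ?_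
  have hv0 : 0 < v := hB.trans hvB
  have h1 := rpow_tangent_le hm hv0.le hB.le
  obtain ⟨r, hr⟩ : ∃ r, r = (v - B) / B := ⟨_, rfl⟩
  have hr0 : 0 ≤ r := by rw [hr]; exact div_nonneg (by linarith) hB.le
  have hvr : v = B * (1 + r) := by rw [hr]; field_simp; ring
  have h2 : v ^ (m - 1) = B ^ (m - 1) * (1 + r) ^ (m - 1) := by
    rw [hvr, Real.mul_rpow hB.le (by linarith)]
  have a1 : (1 + r) ^ (m - 1) ≤ (1 + r) ^ m :=
    Real.rpow_le_rpow_of_exponent_le (by linarith) (by linarith)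
  have a2 := rpow_tangent_le hm (a := 1 + r) (b := 1) (by linarith) (by norm_num)
  have hrS : r ≤ S * T / B := by
    rw [hr]
    have : v - B ≤ S * T := by nlinarith
    gcongr
  have a3 : (1 + r) ^ (m - 1) ≤ (1 + S * T / B) ^ (m - 1) :=
    Real.rpow_le_rpow (by linarith) (by linarith) (by linarith)
  have a4 : m * (1 + r) ^ (m - 1) * r ≤ m * (1 + S * T / B) ^ (m - 1) * r := by gcongr
  rw [Real.one_rpow] at a2
  obtain ⟨P, hP⟩ : ∃ P, P = m * (1 + S * T / B) ^ (m - 1) := ⟨_, rfl⟩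
  rw [← hP] at a4 ⊢
  have hP0 : 0 ≤ P := by rw [hP]; positivity
  have a5 : (1 + r) ^ (m - 1) ≤ 1 + P * r := by linarith
  have h3 : Λ * (m * v ^ (m - 1)) ≤ 1 + P * r := by
    calc Λ * (m * v ^ (m - 1)) = Λ * (m * B ^ (m - 1)) * (1 + r) ^ (m - 1) := by rw [h2]; ring
      _ ≤ 1 * (1 + r) ^ (m - 1) := by gcongr
      _ ≤ _ := by linarith
  have h4 : Λ * (m * v ^ (m - 1)) * (v - B) ≤ (1 + P * r) * (v - B) :=
    mul_le_mul_of_nonneg_right h3 (by linarith)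
  have h5 : P * r * (v - B) ≤ P / B * S ^ 2 * dt ^ 2 := by
    have e : P * r * (v - B) = P / B * (v - B) ^ 2 := by rw [hr]; field_simp
    have : (v - B) ^ 2 ≤ (S * dt) ^ 2 := by
      apply pow_le_pow_left₀ <;> linarith
    rw [e]
    calc P / B * (v - B) ^ 2 ≤ P / B * (S * dt) ^ 2 := by gcongr
      _ = _ := by ring
  nlinarith [mul_le_mul_of_nonneg_left h1 hΛ]

/-- Bounds on the exact solution over one time step at a base node: `u`, `u'` are the old and the
new values on the base, `w₁` is the old value at height `Δx`, `q` is the old time derivative,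
and `τ` stands for `Δx ^ (2 - σ)`. -/
structure ExactStep (m Q Q₁ M C Λ dt τ u u' w₁ q : ℝ) : Prop where
  u_nonneg : 0 ≤ u
  u'_nonneg : 0 ≤ u'
  w₁_nonneg : 0 ≤ w₁
  time : |u' - u - dt * q| ≤ M * dt ^ 2
  flux : |Λ * (w₁ - u ^ m) - dt * q| ≤ C * (dt * τ)
  rel : (m - 1) * |q| ≤ Q * u
  bdd : |q| ≤ Q₁

/-- One step for the supersolution `(u ^ m + c ^ m) ^ (1 / m) + c`. -/
lemma exists_super_step {m Q Q₁ M C B T : ℝ} (hm : 1 ≤ m) (hQ : 0 ≤ Q) (hQ₁ : 0 ≤ Q₁) (hM : 0 ≤ M)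
    (hC : 0 ≤ C) (hB : 0 < B) :
    ∃ A : ℝ, 0 ≤ A ∧ ∀ {Λ dt τ u u' w₁ q U U' W₁ c c' N N₁ N' E : ℝ},
      ExactStep m Q Q₁ M C Λ dt τ u u' w₁ q → 0 ≤ Λ → Λ * (m * B ^ (m - 1)) ≤ 1 →
      0 < dt → dt ≤ T → 0 ≤ τ → 0 ≤ U → U ≤ B → U' ≤ B → U' = U + Λ * (W₁ - U ^ m) →
      0 < c → c ≤ c' → 0 ≤ N → 0 ≤ N₁ → 0 ≤ N' → N ^ m = u ^ m + c ^ m → N₁ ^ m = w₁ + c ^ m →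
      N' ^ m = u' ^ m + c' ^ m → U ≤ N + c → W₁ ≤ (N₁ + c) ^ m + E →
      A * dt * (c + dt + τ) + Λ * E ≤ c' - c → U' ≤ N' + c' := by
  obtain ⟨K, hK, hKr⟩ := exists_rpow_sub_one_bound hm
  obtain ⟨S, hS⟩ : ∃ S, S = Q₁ + M * |T| := ⟨_, rfl⟩
  have hS0 : 0 ≤ S := by rw [hS]; positivity
  obtain ⟨G, hG⟩ : ∃ G, G = m * (1 + S * |T| / B) ^ (m - 1) / B * S ^ 2 := ⟨_, rfl⟩
  have hG0 : 0 ≤ G := by rw [hG]; positivity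
  have hm1 : 0 ≤ m - 1 := by linarith
  -- The three groups are the coefficients of c dt, dt² and dt τ. K Q occurs twice: for the slope ρ
  -- of the norm in time, and for the slope β of the flux.
  refine ⟨2 * (K * Q) + (G + M + K * (m - 1) * M) + (C + K * (m - 1) * C), by positivity, ?_⟩
  intro Λ dt τ u u' w₁ q U U' W₁ c c' N N₁ N' E hx hΛ hcfl hdt hdtT hτ hU hUB hU'B hU' hc hcc
    hN hN₁ hN' hNe hNe₁ hNe' hUN hW hstep
  obtain ⟨hu, hu', hw₁, htime, hflux, hrel, hbdd⟩ := hx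
  have hT0 : 0 ≤ T := hdt.le.trans hdtT
  rw [abs_of_nonneg hT0] at hS hG
  have hcm : 0 < c ^ m := Real.rpow_pos_of_pos hc m
  have hum : 0 ≤ u ^ m := Real.rpow_nonneg hu m
  have hcN : c ≤ N := le_of_rpow_le_rpow hm hc.le hN (by linarith)
  have huN : u ≤ N := le_of_rpow_le_rpow hm hu hN (by linarith)
  have hN0 : 0 < N := hc.trans_le hcN
  have hNuc : N ≤ u + c := le_of_rpow_le_rpow hm hN (by linarith)
    (by rw [hNe]; exact Real.add_rpow_le_rpow_add hu hc.le hm)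
  -- the intermediate norm with the old `c`
  obtain ⟨N₂, hN₂, hNe₂⟩ : ∃ N₂, 0 ≤ N₂ ∧ N₂ ^ m = u' ^ m + c ^ m := by
    have h0 : 0 ≤ u' ^ m + c ^ m := add_nonneg (Real.rpow_nonneg hu' m) hcm.le
    refine ⟨(u' ^ m + c ^ m) ^ (1 / m), Real.rpow_nonneg h0 _, ?_⟩
    rw [← Real.rpow_mul h0, one_div_mul_cancel (by linarith), Real.rpow_one]
  have hN₂' : N₂ ≤ N' := le_of_rpow_le_rpow hm hN₂ hN' (by
    rw [hNe₂, hNe']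
    have := Real.rpow_le_rpow hc.le hcc (by linarith : 0 ≤ m)
    linarith)
  have htan := lpNorm_tangent_le hm hc.le hu hu' hN0 hN₂ hNe hNe₂
  have hr : c / N ∈ Icc (0 : ℝ) 1 := ⟨by positivity, (div_le_one hN0).2 hcN⟩
  have hdq : dt * q ≤ dt * |q| := mul_le_mul_of_nonneg_left (le_abs_self q) hdt.le
  obtain ⟨t1, t2⟩ := abs_le.1 htime
  obtain ⟨f1, f2⟩ := abs_le.1 hflux
  -- The degenerate factor 1/N cancels here, because (m - 1)|q| ≤ Q u and u ≤ N.
  have hrq : (m - 1) * (c / N) * |q| ≤ Q * c := by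
    calc (m - 1) * (c / N) * |q| = ((m - 1) * |q|) * c / N := by ring
      _ ≤ (Q * u) * c / N := by gcongr
      _ = Q * c * (u / N) := by ring
      _ ≤ Q * c * 1 := by
        have : u / N ≤ 1 := (div_le_one hN0).2 huN
        gcongr
      _ = _ := by ring
  have hslope : ∀ {e z : ℝ}, 0 ≤ e → z ≤ dt * |q| + e →
      K * ((m - 1) * (c / N)) * z ≤ K * Q * c * dt + K * (m - 1) * e := by
    intro e z he hz
    have h0 : 0 ≤ K * ((m - 1) * (c / N)) := by positivity
    have h1 := mul_le_mul_of_nonneg_left hrq (mul_nonneg hK hdt.le)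
    have h2 : K * ((m - 1) * (c / N)) * e ≤ K * ((m - 1) * 1) * e := by
      have := hr.2
      gcongr
    calc _ ≤ K * ((m - 1) * (c / N)) * (dt * |q| + e) := mul_le_mul_of_nonneg_left hz h0
      _ = K * dt * ((m - 1) * (c / N) * |q|) + K * ((m - 1) * (c / N)) * e := by ring
      _ ≤ _ := by linarith
  -- time increment of the norm
  obtain ⟨ρ, hρ⟩ : ∃ ρ, ρ = (u / N) ^ (m - 1) := ⟨_, rfl⟩
  rw [← hρ] at htan
  have hρ1 : ρ ≤ 1 := by
    rw [hρ]; exact Real.rpow_le_one (by positivity) ((div_le_one hN0).2 huN) hm1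
  have hρ0 : 0 ≤ ρ := by rw [hρ]; positivity
  have hρK : 1 - ρ ≤ K * ((m - 1) * (c / N)) := by
    have e : u / N = 1 - (N - u) / N := by field_simp; ring
    have := (hKr ((N - u) / N) ⟨div_nonneg (by linarith) hN, (div_le_one hN0).2 (by linarith)⟩).2
    rw [← e, ← hρ] at this
    refine this.trans ?_
    have : N - u ≤ c := by linarith
    gcongr
  have hinc : u' - u - (K * Q * c * dt + K * (m - 1) * (M * dt ^ 2)) ≤ N₂ - N := by
    have hb : 0 ≤ K * Q * c * dt + K * (m - 1) * (M * dt ^ 2) := by positivity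
    rcases le_total u' u with h | h
    · have := mul_nonneg (sub_nonneg.2 hρ1) (sub_nonneg.2 h)
      linarith
    · have := hslope (e := M * dt ^ 2) (z := u' - u) (by positivity) (by linarith)
      have h3 := mul_le_mul_of_nonneg_right hρK (sub_nonneg.2 h)
      linarith
  -- A new barrier above B needs no proof, by stability. Otherwise the old barrier exceeds B by at
  -- most S dt, since the norm drops by at most S dt in one step.
  rcases le_or_gt B (N' + c') with hv' | hv'
  · exact hU'B.trans hv'
  -- near `B`
  have hvB : N + c ≤ B + S * dt := by
    have hd : u - u' ≤ S * dt := by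
      have h1 : dt * |q| ≤ dt * Q₁ := mul_le_mul_of_nonneg_left hbdd hdt.le
      have h2 : dt * (-q) ≤ dt * |q| := mul_le_mul_of_nonneg_left (neg_le_abs q) hdt.le
      have h3 : M * dt ^ 2 ≤ M * T * dt := by
        rw [pow_two, ← mul_assoc]; gcongr
      rw [hS]
      linarith
    have : N - N₂ ≤ S * dt := by
      rcases le_total u' u with h | h
      · have := mul_nonneg (sub_nonneg.2 hρ1) (sub_nonneg.2 h)
        linarith
      · have : 0 ≤ S * dt := by positivity
        have := mul_nonneg hρ0 (sub_nonneg.2 h)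
        linarith
    linarith
  have hg := step_mono_beyond hm hΛ hB hcfl hU hUB hUN hS0 hdt.le hdtT hvB
  rw [← hG] at hg
  have htop := add_rpow_le_tangent hm hc.le hN0 hN₁
  obtain ⟨β, hβ⟩ : ∃ β, β = ((N + c) / N) ^ (m - 1) := ⟨_, rfl⟩
  have eN : (N + c) / N = 1 + c / N := by field_simp
  have hβK : β - 1 ≤ K * ((m - 1) * (c / N)) := by rw [hβ, eN]; exact (hKr _ hr).1
  have hβ1 : 1 ≤ β := by rw [hβ, eN]; exact Real.one_le_rpow (by linarith [hr.1]) hm1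
  rw [← hβ, hNe₁, hNe] at htop
  have e3 : w₁ + c ^ m - (u ^ m + c ^ m) = w₁ - u ^ m := by ring
  rw [e3] at htop
  have hβw : (β - 1) * (Λ * (w₁ - u ^ m)) ≤ K * Q * c * dt + K * (m - 1) * (C * (dt * τ)) := by
    have hb : 0 ≤ K * Q * c * dt + K * (m - 1) * (C * (dt * τ)) := by positivity
    rcases le_total (Λ * (w₁ - u ^ m)) 0 with h | h
    · exact (mul_nonpos_of_nonneg_of_nonpos (by linarith) h).trans hb
    · refine (mul_le_mul_of_nonneg_right hβK h).trans (hslope (by positivity) (by linarith))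
  have h1 : Λ * W₁ ≤ Λ * ((N + c) ^ m + β * (w₁ - u ^ m) + E) :=
    mul_le_mul_of_nonneg_left (by linarith) hΛ
  have hstep' : 2 * (K * Q) * (c * dt) + (G + M + K * (m - 1) * M) * dt ^ 2
      + (C + K * (m - 1) * C) * (dt * τ) + Λ * E ≤ c' - c := by
    refine le_trans ?_ hstep
    have p1 : 0 ≤ 2 * (K * Q) := by positivity
    have p2 : 0 ≤ G + M + K * (m - 1) * M := by positivity
    have p3 : 0 ≤ C + K * (m - 1) * C := by positivity
    have q1 : 0 ≤ c * dt := by positivity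
    have q2 : 0 ≤ dt ^ 2 := by positivity
    have q3 : 0 ≤ dt * τ := by positivity
    have := mul_nonneg p1 q2
    have := mul_nonneg p1 q3
    have := mul_nonneg p2 q1
    have := mul_nonneg p2 q3
    have := mul_nonneg p3 q1
    have := mul_nonneg p3 q2
    linarith
  rw [hU']
  linarith

/-- One step for the subsolution `(u - c)₊`. -/
lemma exists_sub_step {m Q Q₁ M C B : ℝ} (hm : 1 ≤ m) (hQ : 0 ≤ Q) (hM : 0 ≤ M) (hC : 0 ≤ C) :
    ∃ A : ℝ, 0 ≤ A ∧ ∀ {Λ dt τ u u' w₁ q U U' W₁ c c' u₁ E : ℝ},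
      ExactStep m Q Q₁ M C Λ dt τ u u' w₁ q → 0 ≤ Λ → Λ * (m * B ^ (m - 1)) ≤ 1 →
      0 < dt → 0 ≤ τ → U ≤ B → U' = U + Λ * (W₁ - U ^ m) → 0 < c →
      0 ≤ u₁ → u₁ ^ m = w₁ → max (u - c) 0 ≤ U → (max (u₁ - c) 0) ^ m - E ≤ W₁ →
      A * dt * (c + dt + τ) + Λ * E ≤ c' - c → u' - c' ≤ U' := by
  obtain ⟨K, hK, hKr⟩ := exists_rpow_sub_one_bound hm
  have hm1 : 0 ≤ m - 1 := by linarith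
  -- For m = 1 the first quotient is 0 by the convention for division; the linear case is treated
  -- separately and does not use it.
  refine ⟨(Q / (m - 1) + K * Q) + M + (2 * C + K * (m - 1) * C), by positivity, ?_⟩
  intro Λ dt τ u u' w₁ q U U' W₁ c c' u₁ E hx hΛ hcfl hdt hτ hUB hU' hc hu₁ hue₁ hvU hW hstep
  obtain ⟨hu, hu', hw₁, htime, hflux, hrel, hbdd⟩ := hx
  obtain ⟨t1, t2⟩ := abs_le.1 htime
  obtain ⟨f1, f2⟩ := abs_le.1 hflux
  have hg := step_mono hm hΛ hcfl (le_max_right (u - c) 0) hvU hUB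
  have h1 : Λ * ((max (u₁ - c) 0) ^ m - E) ≤ Λ * W₁ := mul_le_mul_of_nonneg_left hW hΛ
  have hdq : dt * q ≤ dt * |q| := mul_le_mul_of_nonneg_left (le_abs_self q) hdt.le
  have hstep' : (Q / (m - 1) + K * Q) * (c * dt) + M * dt ^ 2
      + (2 * C + K * (m - 1) * C) * (dt * τ) + Λ * E ≤ c' - c := by
    refine le_trans ?_ hstep
    have p1 : 0 ≤ Q / (m - 1) + K * Q := by positivity
    have p3 : 0 ≤ 2 * C + K * (m - 1) * C := by positivity
    have q1 : 0 ≤ c * dt := by positivity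
    have q2 : 0 ≤ dt ^ 2 := by positivity
    have q3 : 0 ≤ dt * τ := by positivity
    have := mul_nonneg p1 q2
    have := mul_nonneg p1 q3
    have := mul_nonneg hM q1
    have := mul_nonneg hM q3
    have := mul_nonneg p3 q1
    have := mul_nonneg p3 q2
    linarith
  -- the discrete flux of the subsolution
  have key : u - c + Λ * (w₁ - u ^ m) - ((Q / (m - 1) + K * Q) * (c * dt)
      + (C + K * (m - 1) * C) * (dt * τ))
      ≤ max (u - c) 0 - Λ * (max (u - c) 0) ^ m + Λ * (max (u₁ - c) 0) ^ m := by
    have p0 : 0 ≤ (Q / (m - 1) + K * Q) * (c * dt) := by positivity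
    have p1 : 0 ≤ (C + K * (m - 1) * C) * (dt * τ) := by positivity
    rcases hm.eq_or_lt with rfl | hm'
    · rw [Real.rpow_one] at hue₁ ⊢
      rw [Real.rpow_one, Real.rpow_one]
      have a2 := mul_le_mul_of_nonneg_left (le_max_left (u₁ - c) 0) hΛ
      have a3 : Λ ≤ 1 := by simpa using hcfl
      have a4 := mul_nonneg (sub_nonneg.2 a3) (sub_nonneg.2 (le_max_left (u - c) 0))
      rw [← hue₁]
      linarith
    -- Where the barrier is 0, smallness of u gives |q| ≤ Q c/(m - 1), so a flux out of the node
    -- costs only O(c dt). Where it is positive, the tangent inequality applies.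
    rcases le_or_gt u c with huc | huc
    · rw [max_eq_right (a := u - c) (by linarith), Real.zero_rpow (by linarith)]
      have a1 : 0 ≤ Λ * (max (u₁ - c) 0) ^ m :=
        mul_nonneg hΛ (Real.rpow_nonneg (le_max_right _ _) _)
      have a2 : |q| ≤ Q / (m - 1) * c := by
        have : 0 < m - 1 := by linarith
        rw [div_mul_eq_mul_div, le_div_iff₀ this]
        have := mul_le_mul_of_nonneg_left huc hQ
        linarith
      have a3 := mul_le_mul_of_nonneg_left a2 hdt.le
      have a4 : 0 ≤ K * Q * (c * dt) := by positivity
      have a5 : 0 ≤ K * (m - 1) * C * (dt * τ) := by positivity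
      linarith
    · rw [max_eq_left (a := u - c) (by linarith)]
      have hu0 : 0 < u := hc.trans huc
      have htop := tangent_le_sub_rpow hm'.le hc.le huc hu₁
      obtain ⟨β, hβ⟩ : ∃ β, β = (1 - c / u) ^ (m - 1) := ⟨_, rfl⟩
      have hr : c / u ∈ Icc (0 : ℝ) 1 := ⟨by positivity, (div_le_one hu0).2 huc.le⟩
      have hβK : 1 - β ≤ K * ((m - 1) * (c / u)) := by rw [hβ]; exact (hKr _ hr).2
      have hβ1 : β ≤ 1 := by
        rw [hβ]; exact Real.rpow_le_one (by linarith [hr.2]) (by linarith [hr.1]) hm1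
      rw [← hβ, hue₁] at htop
      have a1 := mul_le_mul_of_nonneg_left htop hΛ
      have hrq : (m - 1) * (c / u) * |q| ≤ Q * c := by
        calc (m - 1) * (c / u) * |q| = ((m - 1) * |q|) * c / u := by ring
          _ ≤ (Q * u) * c / u := by gcongr
          _ = Q * c := by field_simp
      have a2 : (1 - β) * (Λ * (w₁ - u ^ m)) ≤ K * Q * (c * dt) + K * (m - 1) * C * (dt * τ) := by
        have a3 : Λ * (w₁ - u ^ m) ≤ dt * |q| + C * (dt * τ) := by linarith
        have a4 : 0 ≤ dt * |q| + C * (dt * τ) := by positivity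
        calc (1 - β) * (Λ * (w₁ - u ^ m)) ≤ (1 - β) * (dt * |q| + C * (dt * τ)) :=
              mul_le_mul_of_nonneg_left a3 (by linarith)
          _ ≤ K * ((m - 1) * (c / u)) * (dt * |q| + C * (dt * τ)) :=
              mul_le_mul_of_nonneg_right hβK a4
          _ = K * dt * ((m - 1) * (c / u) * |q|) + K * ((m - 1) * (c / u)) * (C * (dt * τ)) := by
              ring
          _ ≤ K * dt * (Q * c) + K * ((m - 1) * 1) * (C * (dt * τ)) := by
              have := hr.2
              gcongr
          _ = _ := by ring
      have a5 : 0 ≤ Q / (m - 1) * (c * dt) := by positivity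
      have a6 : 0 ≤ C * (dt * τ) := by positivity
      linarith
  rw [hU']
  linarith

/-! ### Expansions in time and at the base -/

lemma mu_pos {σ : ℝ} (hσ0 : 0 < σ) (hσ2 : σ < 2) : 0 < mu σ := by
  have h1 : 0 < Real.Gamma (σ / 2) := Real.Gamma_pos_of_pos (by linarith)
  have h2 : 0 < Real.Gamma (1 - σ / 2) := Real.Gamma_pos_of_pos (by linarith)
  unfold mu
  positivity

lemma nu_pos {σ : ℝ} (hσ0 : 0 < σ) (hσ2 : σ < 2) : 0 < nu σ :=
  mul_pos hσ0 (mu_pos hσ0 hσ2)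

/-- First-order Taylor estimates for a `C²` function on `[0, T]`. -/
lemma taylor_Icc {u : ℝ → ℝ} {T M : ℝ} (hT : 0 < T) (hu : ContDiffOn ℝ 2 u (Icc 0 T))
    (hM : ∀ t ∈ Icc 0 T, |iteratedDerivWithin 2 u (Icc 0 T) t| ≤ M) :
    (∀ t ∈ Icc 0 T, ∀ s ∈ Icc 0 T,
      |derivWithin u (Icc 0 T) s - derivWithin u (Icc 0 T) t| ≤ M * |s - t|) ∧
    ∀ t ∈ Icc 0 T, ∀ s ∈ Icc 0 T,
      |u s - u t - (s - t) * derivWithin u (Icc 0 T) t| ≤ M * (s - t) ^ 2 := by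
  have hud : UniqueDiffOn ℝ (Icc 0 T) := uniqueDiffOn_Icc hT
  have h1 : ContDiffOn ℝ 1 (derivWithin u (Icc 0 T)) (Icc 0 T) :=
    hu.derivWithin hud (by norm_num)
  have hd1 : ∀ t ∈ Icc 0 T, HasDerivWithinAt (derivWithin u (Icc 0 T))
      (iteratedDerivWithin 2 u (Icc 0 T) t) (Icc 0 T) t := by
    intro t ht
    have := ((h1.differentiableOn (by norm_num)) t ht).hasDerivWithinAt
    have e : iteratedDerivWithin 2 u (Icc 0 T) = derivWithin (derivWithin u (Icc 0 T)) (Icc 0 T) := by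
      rw [iteratedDerivWithin_succ', iteratedDerivWithin_one]
    rwa [e]
  have hd0 : ∀ t ∈ Icc 0 T, HasDerivWithinAt u (derivWithin u (Icc 0 T) t) (Icc 0 T) t :=
    fun t ht => ((hu.differentiableOn (by norm_num)) t ht).hasDerivWithinAt
  have hM0 : 0 ≤ M := (abs_nonneg _).trans (hM 0 ⟨le_rfl, hT.le⟩)
  have lip : ∀ t ∈ Icc 0 T, ∀ s ∈ Icc 0 T,
      |derivWithin u (Icc 0 T) s - derivWithin u (Icc 0 T) t| ≤ M * |s - t| := fun t ht s hs =>
    Convex.norm_image_sub_le_of_norm_hasDerivWithin_le hd1 hM (convex_Icc 0 T) ht hs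
  refine ⟨lip, fun t ht s hs => ?_⟩
  have hsub : uIcc t s ⊆ Icc 0 T := uIcc_subset_Icc ht hs
  have hder : ∀ r ∈ uIcc t s, HasDerivWithinAt (fun r => u r - r * derivWithin u (Icc 0 T) t)
      (derivWithin u (Icc 0 T) r - 1 * derivWithin u (Icc 0 T) t) (uIcc t s) r := fun r hr =>
    ((hd0 r (hsub hr)).mono hsub).sub ((hasDerivWithinAt_id r _).mul_const _)
  have hb : ∀ r ∈ uIcc t s, ‖derivWithin u (Icc 0 T) r - 1 * derivWithin u (Icc 0 T) t‖
      ≤ M * |s - t| := by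
    intro r hr
    rw [one_mul]
    refine (lip t ht r (hsub hr)).trans ?_
    have := abs_sub_left_of_mem_uIcc hr
    gcongr
  have := Convex.norm_image_sub_le_of_norm_hasDerivWithin_le hder hb (convex_uIcc t s)
    left_mem_uIcc right_mem_uIcc
  rw [Real.norm_eq_abs, Real.norm_eq_abs, mul_assoc, abs_mul_abs_self, ← pow_two] at this
  refine le_trans (le_of_eq ?_) this
  congr 1
  ring

/-- If `y ^ (1 - σ) W'` tends to `l` and varies like `y ^ (2 - σ)`, then
`W y = W 0 + (l / σ) y ^ σ + O(y²)`. -/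
lemma flux_expansion {W : ℝ → ℝ} {σ Y M l : ℝ} (hσ0 : 0 < σ) (hσ2 : σ < 2)
    (hc : ContinuousOn W (Icc 0 Y)) (hd : ∀ y ∈ Ioo 0 Y, DifferentiableAt ℝ W y)
    (hg : ∀ y ∈ Ioo 0 Y, DifferentiableAt ℝ (fun s => s ^ (1 - σ) * deriv W s) y)
    (hgM : ∀ y ∈ Ioo 0 Y, |deriv (fun s => s ^ (1 - σ) * deriv W s) y| ≤ M * y ^ (1 - σ))
    (hl : Tendsto (fun s => s ^ (1 - σ) * deriv W s) (𝓝[>] 0) (𝓝 l)) :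
    ∀ y ∈ Icc 0 Y, |W y - W 0 - l / σ * y ^ σ| ≤ M / (2 * (2 - σ)) * y ^ 2 := by
  obtain ⟨g, hgdef⟩ : ∃ g, g = fun s => s ^ (1 - σ) * deriv W s := ⟨_, rfl⟩
  rw [← hgdef] at hl
  simp only [← hgdef] at hg hgM
  have h2σ : 0 < 2 - σ := by linarith
  have hpow : ∀ y ∈ Ioo 0 Y, HasDerivAt (fun s : ℝ => M / (2 - σ) * s ^ (2 - σ))
      (M * y ^ (1 - σ)) y := by
    intro y hy
    have := (Real.hasDerivAt_rpow_const (x := y) (p := 2 - σ) (Or.inl hy.1.ne')).const_mul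
      (M / (2 - σ))
    refine this.congr_deriv ?_
    have e : 2 - σ - 1 = 1 - σ := by ring
    rw [e]
    field_simp
  -- the flux differs from its limit by `O(y ^ (2 - σ))`
  have hmono : ∀ ε : ℝ, |ε| = 1 → MonotoneOn (fun s => M / (2 - σ) * s ^ (2 - σ) + ε * g s)
      (Ioo 0 Y) := by
    -- The choices ε = 1 and ε = -1 give the two one-sided bounds; letting s tend to 0 in the
    -- monotone function replaces an integration from the singular endpoint.
    intro ε hε
    have hder : ∀ y ∈ Ioo 0 Y, HasDerivAt (fun s => M / (2 - σ) * s ^ (2 - σ) + ε * g s)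
        (M * y ^ (1 - σ) + ε * deriv g y) y := fun y hy =>
      (hpow y hy).add ((hg y hy).hasDerivAt.const_mul ε)
    refine monotoneOn_of_deriv_nonneg (convex_Ioo 0 Y)
      (fun y hy => (hder y hy).continuousAt.continuousWithinAt) ?_ ?_
    · rw [interior_Ioo]
      exact fun y hy => (hder y hy).differentiableAt.differentiableWithinAt
    · rw [interior_Ioo]
      intro y hy
      rw [(hder y hy).deriv]
      have h1 := hgM y hy
      have h2 : |ε * deriv g y| ≤ M * y ^ (1 - σ) := by rwa [abs_mul, hε, one_mul]
      linarith [(abs_le.1 h2).1]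
  have hlim : ∀ ε : ℝ, |ε| = 1 → ∀ y ∈ Ioo 0 Y, ε * l ≤ M / (2 - σ) * y ^ (2 - σ) + ε * g y := by
    intro ε hε y hy
    have ht : Tendsto (fun s : ℝ => M / (2 - σ) * s ^ (2 - σ) + ε * g s) (𝓝[>] 0)
        (𝓝 (M / (2 - σ) * 0 ^ (2 - σ) + ε * l)) := by
      refine Tendsto.add (Tendsto.const_mul _ ?_) (hl.const_mul ε)
      exact ((Real.continuousAt_rpow_const 0 (2 - σ) (Or.inr h2σ.le)).tendsto).mono_left
        nhdsWithin_le_nhds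
    rw [Real.zero_rpow h2σ.ne', mul_zero, zero_add] at ht
    refine le_of_tendsto ht ?_
    filter_upwards [Ioo_mem_nhdsGT hy.1] with s hs
    exact hmono ε hε ⟨hs.1, hs.2.trans hy.2⟩ hy hs.2.le
  -- integrate
  have hmono2 : ∀ ε : ℝ, |ε| = 1 → MonotoneOn
      (fun s => M / (2 * (2 - σ)) * s ^ 2 + ε * (W s - l / σ * s ^ σ)) (Icc 0 Y) := by
    intro ε hε
    have hder : ∀ y ∈ Ioo 0 Y, HasDerivAt
        (fun s => M / (2 * (2 - σ)) * s ^ 2 + ε * (W s - l / σ * s ^ σ))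
        (y ^ (σ - 1) * (M / (2 - σ) * y ^ (2 - σ) + ε * g y - ε * l)) y := by
      intro y hy
      have h1 := (hd y hy).hasDerivAt.sub
        ((Real.hasDerivAt_rpow_const (x := y) (p := σ) (Or.inl hy.1.ne')).const_mul (l / σ))
      have h2 := ((hasDerivAt_pow 2 y).const_mul (M / (2 * (2 - σ)))).add (h1.const_mul ε)
      refine h2.congr_deriv ?_
      have e1 : y ^ (σ - 1) * y ^ (2 - σ) = y := by
        rw [← Real.rpow_add hy.1]
        have : σ - 1 + (2 - σ) = 1 := by ring
        rw [this, Real.rpow_one]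
      have e2 : y ^ (σ - 1) * g y = deriv W y := by
        rw [hgdef]
        show y ^ (σ - 1) * (y ^ (1 - σ) * deriv W y) = deriv W y
        rw [← mul_assoc, ← Real.rpow_add hy.1]
        have : σ - 1 + (1 - σ) = 0 := by ring
        rw [this, Real.rpow_zero, one_mul]
      have e3 : y ^ (σ - 1) * (M / (2 - σ) * y ^ (2 - σ) + ε * g y - ε * l)
          = M / (2 - σ) * (y ^ (σ - 1) * y ^ (2 - σ)) + ε * (y ^ (σ - 1) * g y)
            - ε * l * y ^ (σ - 1) := by ring
      rw [e3, e1, e2]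
      field_simp
      norm_num
      ring
    refine monotoneOn_of_deriv_nonneg (convex_Icc 0 Y) ?_ ?_ ?_
    · refine ContinuousOn.add (by fun_prop) (ContinuousOn.mul continuousOn_const (hc.sub ?_))
      exact continuousOn_const.mul (Real.continuous_rpow_const hσ0.le).continuousOn
    · rw [interior_Icc]
      exact fun y hy => (hder y hy).differentiableAt.differentiableWithinAt
    · rw [interior_Icc]
      intro y hy
      rw [(hder y hy).deriv]
      exact mul_nonneg (Real.rpow_nonneg hy.1.le _) (by linarith [hlim ε hε y hy])
  intro y hy
  have h0 : (0 : ℝ) ∈ Icc 0 Y := ⟨le_rfl, hy.1.trans hy.2⟩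
  have h1 := hmono2 1 (by simp) h0 hy hy.1
  have h2 := hmono2 (-1) (by simp) h0 hy hy.1
  simp only [Real.zero_rpow hσ0.ne'] at h1 h2
  rw [abs_le]
  constructor <;> linarith

/-- The value of `w` on the base raised to `1 / m`. -/
noncomputable abbrev baseU (m : ℝ) (w : ℝ → ℝ → ℝ → ℝ) (x t : ℝ) : ℝ := w x 0 t ^ (1 / m)

/-- The time derivative of `w ^ (1 / m)` on the base. -/
noncomputable abbrev baseQ (m T : ℝ) (w : ℝ → ℝ → ℝ → ℝ) (x t : ℝ) : ℝ :=
  derivWithin (fun s => w x 0 s ^ (1 / m)) (Icc 0 T) t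

/-! ### Estimates for the exact solution -/

section Exact

variable {σ m X Y T : ℝ} {f : ℝ → ℝ} {w : ℝ → ℝ → ℝ → ℝ}

lemma IsClassicalSolution.continuousOn_time (hw : IsClassicalSolution σ m X Y T f w) {x y : ℝ}
    (hx : x ∈ Icc (-X) X) (hy : y ∈ Icc 0 Y) : ContinuousOn (fun t => w x y t) (Icc 0 T) :=
  hw.continuousOn.comp (f := fun t => (x, y, t)) (by fun_prop) fun _ ht => ⟨hx, hy, ht⟩

lemma IsClassicalSolution.continuousOn_y (hw : IsClassicalSolution σ m X Y T f w) {x t : ℝ}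
    (hx : x ∈ Icc (-X) X) (ht : t ∈ Icc 0 T) : ContinuousOn (fun y => w x y t) (Icc 0 Y) :=
  hw.continuousOn.comp (f := fun y => (x, y, t)) (by fun_prop) fun _ hy => ⟨hx, hy, ht⟩

lemma IsClassicalSolution.exists_bound (hw : IsClassicalSolution σ m X Y T f w) :
    ∃ S : ℝ, 0 ≤ S ∧ ∀ x ∈ Icc (-X) X, ∀ y ∈ Icc 0 Y, ∀ t ∈ Icc 0 T, w x y t ≤ S := by
  obtain ⟨S, hS⟩ :=
    (isCompact_Icc.prod (isCompact_Icc.prod isCompact_Icc)).exists_bound_of_continuousOn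
      hw.continuousOn
  refine ⟨max S 0, le_max_right _ _, fun x hx y hy t ht => ?_⟩
  exact ((le_abs_self _).trans (hS (x, y, t) ⟨hx, hy, ht⟩)).trans (le_max_left _ _)

/-- The lateral condition is imposed only for y > 0; continuity in y adds the two corners on the
base. -/
lemma IsClassicalSolution.corner (hw : IsClassicalSolution σ m X Y T f w) (hX : 0 < X)
    (hY : 0 < Y) {x t : ℝ} (hx : x = -X ∨ x = X) (ht : t ∈ Icc 0 T) : w x 0 t = 0 := by
  have hx' : x ∈ Icc (-X) X := by rcases hx with rfl | rfl <;> constructor <;> linarith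
  have hc := hw.continuousOn_y hx' ht
  rw [← closure_Ioc hY.ne] at hc
  have heq : EqOn (fun y => w x y t) (fun _ => 0) (Ioc 0 Y) := fun y hy =>
    hw.lateral t ht x hx' y hy (by tauto)
  have h0 : (0 : ℝ) ∈ closure (Ioc 0 Y) := by rw [closure_Ioc hY.ne]; exact ⟨le_rfl, hY.le⟩
  exact heq.of_subset_closure hc continuousOn_const subset_closure subset_rfl h0

lemma IsClassicalSolution.continuousOn_baseU (hw : IsClassicalSolution σ m X Y T f w)
    (hm : 1 ≤ m) (hY : 0 < Y) {x : ℝ} (hx : x ∈ Icc (-X) X) :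
    ContinuousOn (fun t => baseU m w x t) (Icc 0 T) :=
  (hw.continuousOn_time hx ⟨le_rfl, hY.le⟩).rpow_const fun _ _ => Or.inr (by positivity)

lemma continuousOn_baseQ (hr : IsRegularSolution σ m X Y T w) (hT : 0 < T) {x : ℝ}
    (hx : x ∈ Icc (-X) X) : ContinuousOn (fun t => baseQ m T w x t) (Icc 0 T) :=
  (hr.time x hx).continuousOn_derivWithin (uniqueDiffOn_Icc hT) (by norm_num)

/-- The time truncation error is of order two. -/
lemma exists_time_bound (hr : IsRegularSolution σ m X Y T w) (hT : 0 < T) :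
    ∃ M : ℝ, 0 ≤ M ∧ ∀ x ∈ Icc (-X) X, (∀ t ∈ Icc 0 T, ∀ s ∈ Icc 0 T,
      |baseQ m T w x s - baseQ m T w x t| ≤ M * |s - t|) ∧ ∀ t ∈ Icc 0 T, ∀ s ∈ Icc 0 T,
      |baseU m w x s - baseU m w x t - (s - t) * baseQ m T w x t| ≤ M * (s - t) ^ 2 := by
  obtain ⟨M, hM⟩ := hr.time_bound
  exact ⟨max M 0, le_max_right _ _, fun x hx => taylor_Icc hT (hr.time x hx)
    fun t ht => (hM x hx t ht).trans (le_max_left _ _)⟩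

/-- The time derivative on the base is bounded. -/
lemma exists_baseQ_bound (hw : IsClassicalSolution σ m X Y T f w)
    (hr : IsRegularSolution σ m X Y T w) (hm : 1 ≤ m) (hY : 0 < Y) (hT : 0 < T) :
    ∃ Q : ℝ, 0 ≤ Q ∧ ∀ x ∈ Icc (-X) X, ∀ t ∈ Icc 0 T, |baseQ m T w x t| ≤ Q := by
  obtain ⟨M, hM0, hM⟩ := exists_time_bound hr hT
  obtain ⟨S, hS0, hS⟩ := hw.exists_bound
  -- Taylor's formula between 0 and T bounds the derivative at 0 through the oscillation of u; the
  -- bound on the second derivative moves it to any t at a cost of M T.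
  refine ⟨(S ^ (1 / m) + M * T ^ 2) / T + M * T, by positivity, fun x hx t ht => ?_⟩
  have h0 : (0 : ℝ) ∈ Icc 0 T := ⟨le_rfl, hT.le⟩
  have hTT : T ∈ Icc 0 T := ⟨hT.le, le_rfl⟩
  have hy : (0 : ℝ) ∈ Icc 0 Y := ⟨le_rfl, hY.le⟩
  have hu : ∀ s ∈ Icc 0 T, 0 ≤ baseU m w x s ∧ baseU m w x s ≤ S ^ (1 / m) := fun s hs =>
    ⟨Real.rpow_nonneg (hw.nonneg x hx 0 hy s hs) _,
      Real.rpow_le_rpow (hw.nonneg x hx 0 hy s hs) (hS x hx 0 hy s hs) (by positivity)⟩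
  have h1 := abs_le.1 ((hM x hx).2 0 h0 T hTT)
  have h2 := (hM x hx).1 0 h0 t ht
  rw [sub_zero] at h1 h2
  obtain ⟨a1, a2⟩ := hu 0 h0
  obtain ⟨b1, b2⟩ := hu T hTT
  have h3 : |T * baseQ m T w x 0| ≤ S ^ (1 / m) + M * T ^ 2 := by
    rw [abs_le]; constructor <;> linarith [h1.1, h1.2]
  rw [abs_mul, abs_of_pos hT, mul_comm, ← le_div_iff₀ hT] at h3
  have h4 : M * |t| ≤ M * T := by
    rw [abs_of_nonneg ht.1]; exact mul_le_mul_of_nonneg_left ht.2 hM0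
  have h5 := abs_sub_abs_le_abs_sub (baseQ m T w x t) (baseQ m T w x 0)
  linarith

lemma baseQ_hasSigmaDeriv (hw : IsClassicalSolution σ m X Y T f w) (hT : 0 < T) {x t : ℝ}
    (hx : x ∈ Icc (-X) X) (ht : t ∈ Ioc 0 T) :
    HasSigmaDeriv σ (fun x y => w x y t) x (baseQ m T w x t) := by
  obtain ⟨q, hq, hq'⟩ := hw.base t ht x hx
  have : baseQ m T w x t = q := hq'.derivWithin (uniqueDiffOn_Icc hT t ⟨ht.1.le, ht.2⟩)
  rwa [this]

/-- The difference quotient in `y` approximates the flux on the base. -/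
lemma exists_flux_bound (hw : IsClassicalSolution σ m X Y T f w)
    (hr : IsRegularSolution σ m X Y T w) (hσ0 : 0 < σ) (hσ2 : σ < 2) (hY : 0 < Y) (hT : 0 < T) :
    ∃ C : ℝ, 0 ≤ C ∧ ∀ x ∈ Ioo (-X) X, ∀ y ∈ Icc 0 Y, ∀ t ∈ Icc 0 T,
      |w x y t - w x 0 t - baseQ m T w x t / nu σ * y ^ σ| ≤ C * y ^ 2 := by
  obtain ⟨M, hM⟩ := hr.space_bound
  have h2σ : 0 < 2 - σ := by linarith
  have hμ := mu_pos hσ0 hσ2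
  refine ⟨max M 0 / (2 * (2 - σ)), by positivity, fun x hx y hy => ?_⟩
  have hx' : x ∈ Icc (-X) X := Ioo_subset_Icc_self hx
  have main : ∀ t ∈ Ioc 0 T, |w x y t - w x 0 t - baseQ m T w x t / nu σ * y ^ σ|
      ≤ max M 0 / (2 * (2 - σ)) * y ^ 2 := by
    intro t ht
    have hopen : IsOpen (Ioo 0 Y) := isOpen_Ioo
    have hC2 : ContDiffOn ℝ 2 (fun y => w x y t) (Ioo 0 Y) :=
      (hw.contDiffOn t ht).comp (f := fun y => (x, y)) (by fun_prop) fun y hy => ⟨hx, hy⟩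
    have hC1 : ContDiffOn ℝ 1 (deriv fun y => w x y t) (Ioo 0 Y) :=
      hC2.deriv_of_isOpen hopen (by norm_num)
    have hdiff : ∀ y ∈ Ioo 0 Y, DifferentiableAt ℝ (fun y => w x y t) y := fun y hy =>
      ((hC2.differentiableOn (by norm_num)) y hy).differentiableAt (hopen.mem_nhds hy)
    have hlim : Tendsto (fun s => s ^ (1 - σ) * deriv (fun y => w x y t) s) (𝓝[>] 0)
        (𝓝 (baseQ m T w x t / mu σ)) := by
      have := (baseQ_hasSigmaDeriv hw hT hx' ht).div_const (mu σ)
      refine this.congr fun s => ?_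
      field_simp
    have h := flux_expansion (M := max M 0) hσ0 hσ2
      (hw.continuousOn_y hx' ⟨ht.1.le, ht.2⟩) hdiff ?_ ?_ hlim y hy
    · have e : baseQ m T w x t / nu σ = baseQ m T w x t / mu σ / σ := by
        unfold nu; field_simp
      rwa [e]
    · intro y hy
      exact (Real.differentiableAt_rpow_const_of_ne _ hy.1.ne').mul
        (((hC1.differentiableOn (by norm_num)) y hy).differentiableAt (hopen.mem_nhds hy))
    · intro y hy
      -- The equation turns the y-derivative of the weighted flux into -y^(1-σ) ∂ₓ²w, which the
      -- regularity hypothesis bounds.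
      have heq := hw.equation t ht x hx y hy
      unfold Lsig at heq
      rw [deriv_const_mul_field] at heq
      have hMy := hM t ht x hx y hy
      rw [iteratedDeriv_succ, iteratedDeriv_one] at hMy
      have e : deriv (fun s => s ^ (1 - σ) * deriv (fun r => w x r t) s) y
          = -(y ^ (1 - σ) * deriv (deriv fun s => w s y t) x) := by linarith
      have hyp : 0 ≤ y ^ (1 - σ) := Real.rpow_nonneg hy.1.le _
      rw [e, abs_neg, abs_mul, abs_of_nonneg hyp, mul_comm]
      exact mul_le_mul_of_nonneg_right (hMy.trans (le_max_left _ _)) hyp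
  intro t ht
  -- The equation holds for t > 0 only; t = 0, needed for the first time step, follows by
  -- continuity.
  rw [← closure_Ioc hT.ne] at ht
  refine le_on_closure main ?_ continuousOn_const ht
  rw [closure_Ioc hT.ne]
  exact (((hw.continuousOn_time hx' hy).sub (hw.continuousOn_time hx' ⟨le_rfl, hY.le⟩)).sub
    (((continuousOn_baseQ hr hT hx').div_const _).mul continuousOn_const)).abs

/-- The time derivative on the base is controlled by the solution: `(m - 1) |∂ₜu| ≤ Q u`. -/
lemma exists_baseQ_le_baseU (hw : IsClassicalSolution σ m X Y T f w)
    (hr : IsRegularSolution σ m X Y T w) (hσ0 : 0 < σ) (hσ2 : σ < 2) (hm : 1 ≤ m) (hY : 0 < Y)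
    (hT : 0 < T) :
    ∃ Q : ℝ, 0 ≤ Q ∧ ∀ x ∈ Ioo (-X) X, ∀ t ∈ Icc 0 T,
      (m - 1) * |baseQ m T w x t| ≤ Q * baseU m w x t := by
  obtain ⟨C, hC0, hC⟩ := exists_flux_bound hw hr hσ0 hσ2 hY hT
  obtain ⟨R, hR⟩ := hr.base_bound
  have hν := nu_pos hσ0 hσ2
  have h2σ : 0 < 2 - σ := by linarith
  have hm1 : 0 ≤ m - 1 := by linarith
  refine ⟨nu σ * max R 0, by positivity, fun x hx => ?_⟩
  have hx' : x ∈ Icc (-X) X := Ioo_subset_Icc_self hx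
  have hy0 : (0 : ℝ) ∈ Icc 0 Y := ⟨le_rfl, hY.le⟩
  have main : ∀ t ∈ Ioc 0 T,
      (m - 1) * |baseQ m T w x t| ≤ nu σ * max R 0 * baseU m w x t := by
    intro t ht
    have ht' : t ∈ Icc 0 T := ⟨ht.1.le, ht.2⟩
    obtain ⟨q, hq⟩ : ∃ q, q = baseQ m T w x t := ⟨_, rfl⟩
    rw [← hq]
    -- The increment w(y) - w(0) is bounded below by the flux expansion and above through the
    -- increment of φ'(u). Division by y^σ and y → 0 leave the bound by u on the base.
    have hineq : ∀ y ∈ Ioc 0 Y, (m - 1) * (|q| / nu σ - C * y ^ (2 - σ))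
        ≤ max (baseU m w x t) (w x y t ^ (1 / m)) * max R 0 := by
      intro y hy
      have hy' : y ∈ Icc 0 Y := ⟨hy.1.le, hy.2⟩
      have hyσ : 0 < y ^ σ := Real.rpow_pos_of_pos hy.1 σ
      have hinv : ∀ {z : ℝ}, 0 ≤ z → (z ^ (1 / m)) ^ m = z := fun {z} hz => by
        rw [← Real.rpow_mul hz, one_div_mul_cancel (by linarith), Real.rpow_one]
      have hw0 := hw.nonneg x hx' 0 hy0 t ht'
      have hwy := hw.nonneg x hx' y hy' t ht'
      have h1 := abs_rpow_sub_rpow_le hm (Real.rpow_nonneg hw0 (1 / m))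
        (Real.rpow_nonneg hwy (1 / m))
      rw [hinv hw0, hinv hwy] at h1
      have h2 : |m * (w x y t ^ (1 / m)) ^ (m - 1) - m * (w x 0 t ^ (1 / m)) ^ (m - 1)|
          ≤ max R 0 * y ^ σ :=
        (hR t ht x hx y hy).trans (mul_le_mul_of_nonneg_right (le_max_left _ _) hyσ.le)
      have h3 := hC x hx y hy' t ht'
      rw [← hq] at h3
      have h4 : |q| / nu σ * y ^ σ - C * y ^ 2 ≤ |w x y t - w x 0 t| := by
        have e : |q / nu σ * y ^ σ| = |q| / nu σ * y ^ σ := by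
          rw [abs_mul, abs_div, abs_of_pos hν, abs_of_pos hyσ]
        have h5 := abs_sub_abs_le_abs_sub (q / nu σ * y ^ σ) (w x y t - w x 0 t)
        rw [abs_sub_comm (q / nu σ * y ^ σ), e] at h5
        linarith
      have e2 : y ^ 2 = y ^ (2 - σ) * y ^ σ := by
        rw [← Real.rpow_add hy.1, sub_add_cancel]; norm_cast
      have hmax : 0 ≤ max (baseU m w x t) (w x y t ^ (1 / m)) :=
        le_max_of_le_left (Real.rpow_nonneg hw0 _)
      refine le_of_mul_le_mul_right ?_ hyσ
      calc (m - 1) * (|q| / nu σ - C * y ^ (2 - σ)) * y ^ σ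
          = (m - 1) * (|q| / nu σ * y ^ σ - C * y ^ 2) := by rw [e2]; ring
        _ ≤ (m - 1) * |w x y t - w x 0 t| := mul_le_mul_of_nonneg_left h4 hm1
        _ ≤ _ := h1
        _ ≤ max (baseU m w x t) (w x y t ^ (1 / m)) * (max R 0 * y ^ σ) :=
            mul_le_mul_of_nonneg_left h2 hmax
        _ = _ := by ring
    have hcw : Tendsto (fun y => w x y t ^ (1 / m)) (𝓝[>] 0) (𝓝 (baseU m w x t)) := by
      have h1 : ContinuousWithinAt (fun y => w x y t) (Icc 0 Y) 0 := hw.continuousOn_y hx' ht' 0 hy0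
      have h2 : Tendsto (fun y => w x y t) (𝓝[>] 0) (𝓝 (w x 0 t)) :=
        h1.tendsto.mono_left (nhdsWithin_le_of_mem (mem_of_superset (Ioo_mem_nhdsGT hY)
          Ioo_subset_Icc_self))
      exact h2.rpow_const (Or.inr (by positivity))
    have hl : Tendsto (fun y : ℝ => (m - 1) * (|q| / nu σ - C * y ^ (2 - σ))) (𝓝[>] 0)
        (𝓝 ((m - 1) * (|q| / nu σ - C * 0 ^ (2 - σ)))) := by
      refine Tendsto.const_mul _ (tendsto_const_nhds.sub (Tendsto.const_mul _ ?_))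
      exact ((Real.continuousAt_rpow_const 0 (2 - σ) (Or.inr h2σ.le)).tendsto).mono_left
        nhdsWithin_le_nhds
    have hrr : Tendsto (fun y : ℝ => max (baseU m w x t) (w x y t ^ (1 / m)) * max R 0) (𝓝[>] 0)
        (𝓝 (max (baseU m w x t) (baseU m w x t) * max R 0)) :=
      (tendsto_const_nhds.max hcw).mul_const _
    have := le_of_tendsto_of_tendsto hl hrr (by
      filter_upwards [Ioo_mem_nhdsGT hY] with y hy
      exact hineq y ⟨hy.1, hy.2.le⟩)
    rw [Real.zero_rpow h2σ.ne', mul_zero, sub_zero, max_self, ← mul_div_assoc, div_le_iff₀ hν] at this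
    linarith
  intro t ht
  rw [← closure_Ioc hT.ne] at ht
  refine le_on_closure main ?_ ?_ ht <;> rw [closure_Ioc hT.ne]
  · exact continuousOn_const.mul (continuousOn_baseQ hr hT hx').abs
  · exact continuousOn_const.mul (hw.continuousOn_baseU hm hY hx')

end Exact

/-! ### Elementary facts about the mesh -/

namespace Mesh

variable {X Y T : ℝ} (M : Mesh X Y T)

lemma dx_pos (hX : 0 < X) : 0 < M.dx :=
  div_pos (by linarith) (Nat.cast_pos.2 M.I_pos)

lemma dt_pos (hT : 0 < T) : 0 < M.dt := div_pos hT (Nat.cast_pos.2 M.J_pos)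

lemma x_zero : M.x 0 = -X := by simp [x]

lemma x_I : M.x M.I = X := by
  have : (M.I : ℝ) ≠ 0 := Nat.cast_ne_zero.2 M.I_pos.ne'
  unfold x dx
  field_simp
  ring

lemma y_zero : M.y 0 = 0 := by simp [y]

lemma y_one : M.y 1 = M.dx := by simp [y]

lemma y_K : M.y M.K = Y := by
  have : (M.K : ℝ) ≠ 0 := Nat.cast_ne_zero.2 M.K_pos.ne'
  have h : M.dx = Y / M.K := M.square
  unfold y
  rw [h]
  field_simp

lemma t_J : M.t M.J = T := by
  have : (M.J : ℝ) ≠ 0 := Nat.cast_ne_zero.2 M.J_pos.ne'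
  unfold t dt
  field_simp

lemma x_mem (hX : 0 < X) {i : ℕ} (hi : i ≤ M.I) : M.x i ∈ Icc (-X) X := by
  have h := M.dx_pos hX
  have hi' : (i : ℝ) ≤ M.I := Nat.cast_le.2 hi
  constructor
  · unfold x
    have : 0 ≤ (i : ℝ) * M.dx := by positivity
    linarith
  · calc M.x i ≤ M.x M.I := by unfold x; gcongr
      _ = X := M.x_I

lemma x_mem_Ioo (hX : 0 < X) {i : ℕ} (hi0 : 0 < i) (hi : i < M.I) : M.x i ∈ Ioo (-X) X := by
  have h := M.dx_pos hX
  have hi' : (i : ℝ) < M.I := Nat.cast_lt.2 hi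
  have hi0' : (0 : ℝ) < i := Nat.cast_pos.2 hi0
  constructor
  · unfold x
    have : 0 < (i : ℝ) * M.dx := by positivity
    linarith
  · calc M.x i < M.x M.I := by unfold x; gcongr
      _ = X := M.x_I

lemma y_mem (hX : 0 < X) {k : ℕ} (hk : k ≤ M.K) : M.y k ∈ Icc 0 Y := by
  have h := M.dx_pos hX
  have hk' : (k : ℝ) ≤ M.K := Nat.cast_le.2 hk
  refine ⟨by unfold y; positivity, ?_⟩
  calc M.y k ≤ M.y M.K := by unfold y; gcongr
    _ = Y := M.y_K

lemma y_pos (hX : 0 < X) {k : ℕ} (hk : 0 < k) : 0 < M.y k := by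
  have h := M.dx_pos hX
  have hk' : (0 : ℝ) < k := Nat.cast_pos.2 hk
  unfold y; positivity

lemma dx_mem (hX : 0 < X) : M.dx ∈ Icc 0 Y := by
  rw [← M.y_one]; exact M.y_mem hX M.K_pos

lemma t_mem (hT : 0 < T) {j : ℕ} (hj : j ≤ M.J) : M.t j ∈ Icc 0 T := by
  have h := M.dt_pos hT
  have hj' : (j : ℝ) ≤ M.J := Nat.cast_le.2 hj
  refine ⟨by unfold t; positivity, ?_⟩
  calc M.t j ≤ M.t M.J := by unfold t; gcongr
    _ = T := M.t_J

lemma t_zero : M.t 0 = 0 := by simp [t]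

lemma t_succ (j : ℕ) : M.t (j + 1) = M.t j + M.dt := by
  unfold t; push_cast; ring

lemma dt_le (hT : 0 < T) : M.dt ≤ T := by
  have h := (M.t_mem hT (j := 1) M.J_pos).2
  unfold t at h
  simpa using h

end Mesh

/-! ### Discrete comparison, consistency and stability -/

lemma node_cases {I K : ℕ} {b : Fin (I + 1) × Fin (K + 1)} (hb : ¬ IsInteriorNode b) :
    ((b.1 : ℕ) = 0 ∨ (b.1 : ℕ) = I ∨ (b.2 : ℕ) = K) ∨
      (0 < (b.1 : ℕ) ∧ (b.1 : ℕ) < I ∧ (b.2 : ℕ) = 0) := by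
  unfold IsInteriorNode at hb
  have h1 := b.1.is_lt
  have h2 := b.2.is_lt
  omega

/-- A smooth function with `L_σ ψ` bounded away from zero. -/
lemma exists_barrier {σ X Y : ℝ} (hσ0 : 0 < σ) (hX : 0 < X) (hY : 0 < Y) :
    ∃ ψ : ℝ → ℝ → ℝ, ∃ c S : ℝ, ContDiff ℝ ∞ (fun p : ℝ × ℝ => ψ p.1 p.2) ∧ 0 < c ∧ 0 ≤ S ∧
      (∀ x ∈ Icc (-X) X, ∀ y ∈ Icc 0 Y, 0 ≤ ψ x y ∧ ψ x y ≤ S) ∧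
      ∀ x, ∀ y ∈ Ioc 0 Y, c ≤ Lsig σ ψ x y := by
  -- For σ < 1 the function y has L_σ y = (1-σ) y^(-σ), which degenerates at σ = 1; for σ ≥ 1 one
  -- takes x², with L_σ x² = 2 y^(1-σ). Both values are nonincreasing in y in their range of σ, so y
  -- = Y gives the lower bound.
  rcases lt_or_ge σ 1 with hσ | hσ
  · refine ⟨fun _ y => y, (1 - σ) * Y ^ (-σ), Y, by fun_prop,
      mul_pos (by linarith) (Real.rpow_pos_of_pos hY _), hY.le, fun x _ y hy => hy, ?_⟩
    intro x y hy
    have e : Lsig σ (fun _ y => y) x y = (1 - σ) * y ^ (-σ) := by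
      unfold Lsig
      have h1 := (Real.hasDerivAt_rpow_const (x := y) (p := 1 - σ) (Or.inl hy.1.ne')).deriv
      simp only [deriv_const', mul_zero, deriv_id'', mul_one, zero_add]
      rw [h1]
      congr 2
      ring
    rw [e]
    exact mul_le_mul_of_nonneg_left
      (Real.rpow_le_rpow_of_nonpos hy.1 hy.2 (by linarith)) (by linarith)
  · refine ⟨fun x _ => x ^ 2, 2 * Y ^ (1 - σ), X ^ 2, by fun_prop,
      mul_pos (by norm_num) (Real.rpow_pos_of_pos hY _), by positivity, ?_, ?_⟩
    · intro x hx y _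
      exact ⟨by positivity, sq_le_sq' hx.1 hx.2⟩
    · intro x y hy
      have e : Lsig σ (fun x _ => x ^ 2) x y = 2 * y ^ (1 - σ) := by
        unfold Lsig
        have h1 : deriv (fun r : ℝ => r ^ 2) = fun r => 2 * r := by
          funext r; simp
        simp only [h1, deriv_const', mul_zero, add_zero]
        rw [deriv_const_mul_field, deriv_const_mul_field, deriv_id'']
        ring
      rw [e]
      exact mul_le_mul_of_nonneg_left
        (Real.rpow_le_rpow_of_nonpos hy.1 hy.2 (by linarith)) (by norm_num)

section Discrete

variable {σ m X Y T a : ℝ} {f : ℝ → ℝ} {w : ℝ → ℝ → ℝ → ℝ} {D : Discretization}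
  {𝓡 : Set (ℝ → ℝ → ℝ → ℝ)}

/-- The discrete comparison principle with a right-hand side. -/
lemma exists_comparison (hσ0 : 0 < σ) (hX : 0 < X) (hY : 0 < Y) (hT : 0 < T)
    (hsm : ∀ v : ℝ → ℝ → ℝ,
      ContDiff ℝ ∞ (fun p : ℝ × ℝ => v p.1 p.2) → (fun x y _ => v x y) ∈ 𝓡)
    (hD : HasOrder σ X Y T D a 𝓡) (hmax : HasMaxPrinciple X Y T D) :
    ∃ δ : ℝ, 0 < δ ∧ ∃ C : ℝ, 0 ≤ C ∧ ∀ M : Mesh X Y T, M.dx ^ a ≤ δ →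
      ∀ (V : GridFun M.I M.K) (A : ℝ), 0 ≤ A →
        (∀ p, IsInteriorNode p → -(A * M.dx ^ a) ≤ D M.I M.K V p) →
        (∀ b, ¬ IsInteriorNode b → V b ≤ 0) → ∀ p, V p ≤ C * A * M.dx ^ a := by
  obtain ⟨ψ, c, S, hψ, hc, hS, hψb, hψL⟩ := exists_barrier hσ0 hX hY
  obtain ⟨C₀, hC₀⟩ := hD _ (hsm ψ hψ)
  -- Below this threshold consistency costs at most c/2, so the sampled barrier satisfies D g ≥ c/2.
  -- Adding 2AΔx^a/c times g then compensates a defect of AΔx^a.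
  refine ⟨c / (2 * (|C₀| + 1)), by positivity, 2 * S / c, by positivity, ?_⟩
  intro M hδ V A hA hV hVb p
  have hdx := M.dx_pos hX
  have hda : 0 ≤ M.dx ^ a := Real.rpow_nonneg hdx.le _
  obtain ⟨g, hg⟩ : ∃ g, g = toGrid M.I M.K fun i k => ψ (M.x i) (M.y k) := ⟨_, rfl⟩
  have hgD : ∀ p, IsInteriorNode p → c / 2 ≤ D M.I M.K g p := by
    intro p hp
    have h1 := hC₀ M T ⟨hT, le_rfl⟩ p hp
    rw [← hg] at h1
    have h2 := hψL (M.x p.1) (M.y p.2)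
      ⟨M.y_pos hX hp.2.1, (M.y_mem hX hp.2.2.le).2⟩
    have h3 : C₀ * M.dx ^ a ≤ c / 2 := by
      calc C₀ * M.dx ^ a ≤ (|C₀| + 1) * (c / (2 * (|C₀| + 1))) := by
            gcongr
            linarith [le_abs_self C₀]
        _ = c / 2 := by field_simp
    linarith [(abs_le.1 h1).1]
  have hgb : ∀ p, 0 ≤ g p ∧ g p ≤ S := by
    intro p
    rw [hg]
    exact hψb _ (M.x_mem hX (Nat.lt_succ_iff.1 p.1.is_lt)) _
      (M.y_mem hX (Nat.lt_succ_iff.1 p.2.is_lt))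
  have hs : 0 ≤ 2 * A * M.dx ^ a / c := by positivity
  obtain ⟨b, hb, hpb⟩ := hmax M (V + (2 * A * M.dx ^ a / c) • g) (by
    intro p hp
    rw [map_add, map_smul]
    simp only [Pi.add_apply, Pi.smul_apply, smul_eq_mul]
    have h1 := hV p hp
    have h2 := mul_le_mul_of_nonneg_left (hgD p hp) hs
    have e : 2 * A * M.dx ^ a / c * (c / 2) = A * M.dx ^ a := by field_simp
    linarith) p
  simp only [Pi.add_apply, Pi.smul_apply, smul_eq_mul] at hpb
  have h1 := hVb b hb
  have h2 := mul_le_mul_of_nonneg_left (hgb b).2 hs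
  have h3 := mul_nonneg hs (hgb p).1
  have e : 2 * A * M.dx ^ a / c * S = 2 * S / c * A * M.dx ^ a := by ring
  linarith

/-- The exact solution satisfies the discrete equation up to `O(Δx ^ a)`, also at time `0`. -/
lemma exists_consistency (hX : 0 < X) (hT : 0 < T) (hw : IsClassicalSolution σ m X Y T f w)
    (hD : HasOrder σ X Y T D a 𝓡) (hw𝓡 : w ∈ 𝓡) :
    ∃ C : ℝ, 0 ≤ C ∧ ∀ M : Mesh X Y T, ∀ t ∈ Icc 0 T, ∀ p : Fin (M.I + 1) × Fin (M.K + 1),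
      IsInteriorNode p →
        |D M.I M.K (toGrid M.I M.K fun i k => w (M.x i) (M.y k) t) p| ≤ C * M.dx ^ a := by
  obtain ⟨C, hC⟩ := hD w hw𝓡
  refine ⟨|C|, abs_nonneg C, fun M t ht p hp => ?_⟩
  have hda : 0 ≤ M.dx ^ a := Real.rpow_nonneg (M.dx_pos hX).le _
  -- On a fixed mesh D is linear on a finite-dimensional space, hence continuous, so the bound
  -- passes to t = 0 with the same constant.
  rw [← closure_Ioc hT.ne] at ht
  refine le_on_closure (f := fun t =>
    |D M.I M.K (toGrid M.I M.K fun i k => w (M.x i) (M.y k) t) p|) ?_ ?_ continuousOn_const ht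
  · intro t ht
    have h := hC M t ht p hp
    rw [hw.equation t ht _ (M.x_mem_Ioo hX hp.1.1 hp.1.2) _
      ⟨M.y_pos hX hp.2.1, ?_⟩, sub_zero] at h
    · exact h.trans (mul_le_mul_of_nonneg_right (le_abs_self C) hda)
    · have h1 := M.dx_pos hX
      have h2 : ((p.2 : ℕ) : ℝ) < M.K := Nat.cast_lt.2 hp.2.2
      calc M.y p.2 < M.y M.K := by unfold Mesh.y; gcongr
        _ = Y := M.y_K
  · rw [closure_Ioc hT.ne]
    have hcont : ContinuousOn
        (fun t => toGrid M.I M.K fun i k => w (M.x i) (M.y k) t) (Icc 0 T) := by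
      rw [continuousOn_pi]
      intro p
      exact hw.continuousOn_time (M.x_mem hX (Nat.lt_succ_iff.1 p.1.is_lt))
        (M.y_mem hX (Nat.lt_succ_iff.1 p.2.is_lt))
    exact ((continuous_apply p).comp_continuousOn
      ((D M.I M.K).continuous_of_finiteDimensional.comp_continuousOn hcont)).abs

lemma IsClassicalSolution.lateral_node (hw : IsClassicalSolution σ m X Y T f w) (hX : 0 < X)
    (hY : 0 < Y) (M : Mesh X Y T) {t : ℝ} (ht : t ∈ Icc 0 T) {i k : ℕ} (hi : i ≤ M.I)
    (hk : k ≤ M.K) (h : i = 0 ∨ i = M.I ∨ k = M.K) : w (M.x i) (M.y k) t = 0 := by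
  have hcase : M.x i = -X ∨ M.x i = X ∨ M.y k = Y := by
    rcases h with rfl | rfl | rfl
    · exact Or.inl M.x_zero
    · exact Or.inr (Or.inl M.x_I)
    · exact Or.inr (Or.inr M.y_K)
  rcases Nat.eq_zero_or_pos k with rfl | hk0
  · rw [M.y_zero] at hcase ⊢
    refine hw.corner hX hY ?_ ht
    rcases hcase with h | h | h
    · exact Or.inl h
    · exact Or.inr h
    · exact absurd h hY.ne
  · exact hw.lateral t ht _ (M.x_mem hX hi) _ ⟨M.y_pos hX hk0, (M.y_mem hX hk).2⟩ hcase

/-- Comparison of affine functions of the exact solution with discretely harmonic functions. -/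
lemma exists_affine_comparison (hσ0 : 0 < σ) (hX : 0 < X) (hY : 0 < Y) (hT : 0 < T)
    (hw : IsClassicalSolution σ m X Y T f w)
    (hsm : ∀ v : ℝ → ℝ → ℝ,
      ContDiff ℝ ∞ (fun p : ℝ × ℝ => v p.1 p.2) → (fun x y _ => v x y) ∈ 𝓡)
    (hw𝓡 : w ∈ 𝓡) (hD : HasOrder σ X Y T D a 𝓡) (hmax : HasMaxPrinciple X Y T D) :
    ∃ δ : ℝ, 0 < δ ∧ ∃ C : ℝ, 0 ≤ C ∧ ∀ M : Mesh X Y T, M.dx ^ a ≤ δ →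
      ∀ (Z : ℕ → ℕ → ℝ) (α β γ : ℝ), ∀ t ∈ Icc 0 T,
        (∀ p, IsInteriorNode p → D M.I M.K (toGrid M.I M.K Z) p = 0) →
        (∀ i ≤ M.I, ∀ k ≤ M.K, (i = 0 ∨ i = M.I ∨ k = M.K) → Z i k = 0) → α ≤ 0 →
        (∀ i, 0 < i → i < M.I → γ * Z i 0 + α + β * w (M.x i) 0 t ≤ 0) →
        ∀ i ≤ M.I, ∀ k ≤ M.K,
          γ * Z i k + α + β * w (M.x i) (M.y k) t ≤ C * (|α| + |β|) * M.dx ^ a := by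
  obtain ⟨δ, hδ, C₀, hC₀, hcmp⟩ := exists_comparison hσ0 hX hY hT hsm hD hmax
  obtain ⟨C₁, hC₁, hwc⟩ := exists_consistency hX hT hw hD hw𝓡
  -- D is not assumed to annihilate constants; it does so up to O(Δx^a), because the constant 1 is
  -- smooth.
  obtain ⟨C₂, hC₂⟩ := hD _ (hsm (fun _ _ => 1) contDiff_const)
  refine ⟨δ, hδ, C₀ * (|C₂| + C₁), by positivity, ?_⟩
  intro M hM Z α β γ t ht hZ hlat hα hbase i hi k hk
  have hda : 0 ≤ M.dx ^ a := Real.rpow_nonneg (M.dx_pos hX).le _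
  obtain ⟨gw, hgw⟩ : ∃ g, g = toGrid M.I M.K fun i k => w (M.x i) (M.y k) t := ⟨_, rfl⟩
  obtain ⟨g1, hg1⟩ : ∃ g, g = toGrid M.I M.K fun _ _ => (1 : ℝ) := ⟨_, rfl⟩
  have h := hcmp M hM (γ • toGrid M.I M.K Z + α • g1 + β • gw)
    ((|C₂| + C₁) * (|α| + |β|)) (by positivity) ?_ ?_
    (⟨i, Nat.lt_succ_iff.2 hi⟩, ⟨k, Nat.lt_succ_iff.2 hk⟩)
  · simp only [Pi.add_apply, Pi.smul_apply, smul_eq_mul, hg1, hgw, toGrid, mul_one] at h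
    refine h.trans (le_of_eq ?_)
    ring
  · intro p hp
    rw [map_add, map_add, map_smul, map_smul, map_smul]
    simp only [Pi.add_apply, Pi.smul_apply, smul_eq_mul]
    rw [hZ p hp]
    have h1 := hC₂ M T ⟨hT, le_rfl⟩ p hp
    have e1 : Lsig σ (fun _ _ => (1 : ℝ)) (M.x p.1) (M.y p.2) = 0 := by simp [Lsig]
    rw [e1, sub_zero, ← hg1] at h1
    have h2 := hwc M t ht p hp
    rw [← hgw] at h2
    have h1' : |D M.I M.K g1 p| ≤ |C₂| * M.dx ^ a :=
      h1.trans (mul_le_mul_of_nonneg_right (le_abs_self C₂) hda)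
    have h3 : |α * D M.I M.K g1 p| ≤ |α| * (|C₂| * M.dx ^ a) := by rw [abs_mul]; gcongr
    have h4 : |β * D M.I M.K gw p| ≤ |β| * (C₁ * M.dx ^ a) := by rw [abs_mul]; gcongr
    have h5 : 0 ≤ |α| * (C₁ * M.dx ^ a) := by positivity
    have h6 : 0 ≤ |β| * (|C₂| * M.dx ^ a) := by positivity
    linarith [(abs_le.1 h3).1, (abs_le.1 h4).1]
  · intro b hb
    simp only [Pi.add_apply, Pi.smul_apply, smul_eq_mul, hg1, hgw, toGrid, mul_one]
    rcases node_cases hb with h | ⟨h1, h2, h3⟩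
    · rw [hlat _ (Nat.lt_succ_iff.1 b.1.is_lt) _ (Nat.lt_succ_iff.1 b.2.is_lt) h,
        hw.lateral_node hX hY M ht (Nat.lt_succ_iff.1 b.1.is_lt) (Nat.lt_succ_iff.1 b.2.is_lt) h]
      linarith
    · rw [h3, M.y_zero]
      exact hbase _ h1 h2

/-- The discrete maximum principle for discretely harmonic functions vanishing laterally. -/
lemma le_of_base_le (hmax : HasMaxPrinciple X Y T D) (M : Mesh X Y T) {Z : ℕ → ℕ → ℝ} {γ κ : ℝ}
    (hZ : ∀ p, IsInteriorNode p → D M.I M.K (toGrid M.I M.K Z) p = 0)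
    (hlat : ∀ i ≤ M.I, ∀ k ≤ M.K, (i = 0 ∨ i = M.I ∨ k = M.K) → Z i k = 0) (hκ : 0 ≤ κ)
    (hbase : ∀ i, 0 < i → i < M.I → γ * Z i 0 ≤ κ) {i k : ℕ} (hi : i ≤ M.I) (hk : k ≤ M.K) :
    γ * Z i k ≤ κ := by
  obtain ⟨b, hb, hpb⟩ := hmax M (γ • toGrid M.I M.K Z) (by
    intro p hp
    rw [map_smul, Pi.smul_apply, hZ p hp, smul_zero])
    (⟨i, Nat.lt_succ_iff.2 hi⟩, ⟨k, Nat.lt_succ_iff.2 hk⟩)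
  simp only [Pi.smul_apply, smul_eq_mul, toGrid] at hpb
  refine hpb.trans ?_
  rcases node_cases hb with h | ⟨h1, h2, h3⟩
  · rw [hlat _ (Nat.lt_succ_iff.1 b.1.is_lt) _ (Nat.lt_succ_iff.1 b.2.is_lt) h, mul_zero]
    exact hκ
  · rw [h3]; exact hbase _ h1 h2

lemma rpow_inv_rpow' {m z : ℝ} (hm : 1 ≤ m) (hz : 0 ≤ z) : (z ^ (1 / m)) ^ m = z := by
  rw [← Real.rpow_mul hz, one_div_mul_cancel (by linarith), Real.rpow_one]

lemma rpow_rpow_inv' {m z : ℝ} (hm : 1 ≤ m) (hz : 0 ≤ z) : (z ^ m) ^ (1 / m) = z := by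
  rw [← Real.rpow_mul hz, mul_one_div_cancel (by linarith), Real.rpow_one]

/-- Stability of the scheme: `0 ≤ W ≤ B ^ m`, and the explicit step never leaves `[0, B]`. -/
lemma IsNumericalSolution.stable {M : Mesh X Y T} {W : ℕ → ℕ → ℕ → ℝ}
    (hW : IsNumericalSolution σ m f D M W) (hmax : HasMaxPrinciple X Y T D) (hm : 1 ≤ m)
    {B Λ : ℝ} (hX : 0 < X) (hB : 0 ≤ B) (hfB : ∀ x ∈ Icc (-X) X, 0 ≤ f x ∧ f x ≤ B)
    (hΛ : Λ = nu σ * (M.dt / M.dx ^ σ)) (hΛ0 : 0 ≤ Λ) (hcfl : Λ * (m * B ^ (m - 1)) ≤ 1) :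
    ∀ j ≤ M.J, (∀ i ≤ M.I, ∀ k ≤ M.K, 0 ≤ W j i k ∧ W j i k ≤ B ^ m) ∧
      (j < M.J → ∀ i, 0 < i → i < M.I →
        0 ≤ Λ * (W j i 1 - W j i 0) + W j i 0 ^ (1 / m) ∧
        Λ * (W j i 1 - W j i 0) + W j i 0 ^ (1 / m) ≤ B) := by
  have hBm : 0 ≤ B ^ m := Real.rpow_nonneg hB m
  have ext : ∀ j ≤ M.J, (∀ i, 0 < i → i < M.I → 0 ≤ W j i 0 ∧ W j i 0 ≤ B ^ m) →
      ∀ i ≤ M.I, ∀ k ≤ M.K, 0 ≤ W j i k ∧ W j i k ≤ B ^ m := by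
    intro j hj hb i hi k hk
    have h1 := le_of_base_le hmax M (γ := 1) (hW.interior j hj) (hW.lateral j hj) hBm
      (fun i h1 h2 => by linarith [(hb i h1 h2).2]) hi hk
    have h2 := le_of_base_le hmax M (γ := -1) (hW.interior j hj) (hW.lateral j hj) le_rfl
      (fun i h1 h2 => by linarith [(hb i h1 h2).1]) hi hk
    constructor <;> linarith
  have step : ∀ j, (∀ i ≤ M.I, ∀ k ≤ M.K, 0 ≤ W j i k ∧ W j i k ≤ B ^ m) →
      ∀ i, 0 < i → i < M.I → 0 ≤ Λ * (W j i 1 - W j i 0) + W j i 0 ^ (1 / m) ∧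
        Λ * (W j i 1 - W j i 0) + W j i 0 ^ (1 / m) ≤ B := by
    intro j hb i h1 h2
    obtain ⟨a1, a2⟩ := hb i h2.le 0 (Nat.zero_le _)
    obtain ⟨b1, b2⟩ := hb i h2.le 1 M.K_pos
    have hU0 : 0 ≤ W j i 0 ^ (1 / m) := Real.rpow_nonneg a1 _
    have hUB : W j i 0 ^ (1 / m) ≤ B := by
      have := Real.rpow_le_rpow a1 a2 (by positivity : 0 ≤ 1 / m)
      rwa [rpow_rpow_inv' hm hB] at this
    have e := rpow_inv_rpow' hm a1
    -- Comparison of U with the constant states 0 and B: 0 ≤ U - Λ U^m ≤ B - Λ B^m, to which 0 ≤ Λ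
    -- W₁ ≤ Λ B^m is added.
    have s1 := step_mono hm hΛ0 hcfl le_rfl hU0 hUB
    have s2 := step_mono hm hΛ0 hcfl hU0 hUB le_rfl
    rw [e, Real.zero_rpow (by linarith)] at s1
    rw [e] at s2
    have := mul_nonneg hΛ0 b1
    have := mul_le_mul_of_nonneg_left b2 hΛ0
    constructor <;> linarith
  have main : ∀ j ≤ M.J, ∀ i ≤ M.I, ∀ k ≤ M.K, 0 ≤ W j i k ∧ W j i k ≤ B ^ m := by
    intro j
    induction j with
    | zero =>
      intro hj
      refine ext 0 hj fun i h1 h2 => ?_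
      obtain ⟨c1, c2⟩ := hfB _ (M.x_mem hX h2.le)
      rw [hW.init i h1 h2]
      exact ⟨Real.rpow_nonneg c1 _, Real.rpow_le_rpow c1 c2 (by linarith)⟩
    | succ j ih =>
      intro hj
      refine ext (j + 1) hj fun i h1 h2 => ?_
      obtain ⟨c1, c2⟩ := step j (ih (by omega)) i h1 h2
      rw [hW.step j (by omega) i h1 h2, ← hΛ]
      exact ⟨Real.rpow_nonneg c1 _, Real.rpow_le_rpow c1 c2 (by linarith)⟩
  exact fun j hj => ⟨main j hj, fun _ => step j (main j hj)⟩

end Discrete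

/-! ### Transfer of the barriers from the base to all nodes -/

/-- `(s + c ^ m) ^ (1 / m)`, the `ℓ^m` norm of `(s ^ (1 / m), c)`. -/
noncomputable def shiftRoot (m c s : ℝ) : ℝ := (s + c ^ m) ^ (1 / m)

lemma shiftRoot_nonneg {m c s : ℝ} (hc : 0 ≤ c) (hs : 0 ≤ s) : 0 ≤ shiftRoot m c s :=
  Real.rpow_nonneg (add_nonneg hs (Real.rpow_nonneg hc m)) _

lemma shiftRoot_rpow {m c s : ℝ} (hm : 1 ≤ m) (hc : 0 ≤ c) (hs : 0 ≤ s) :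
    shiftRoot m c s ^ m = s + c ^ m :=
  rpow_inv_rpow' hm (add_nonneg hs (Real.rpow_nonneg hc m))

lemma le_shiftRoot {m c s : ℝ} (hm : 1 ≤ m) (hc : 0 ≤ c) (hs : 0 ≤ s) : c ≤ shiftRoot m c s :=
  le_of_rpow_le_rpow hm hc (shiftRoot_nonneg hc hs) (by rw [shiftRoot_rpow hm hc hs]; linarith)

lemma root_le_shiftRoot {m c s : ℝ} (hm : 1 ≤ m) (hc : 0 ≤ c) (hs : 0 ≤ s) :
    s ^ (1 / m) ≤ shiftRoot m c s :=
  Real.rpow_le_rpow hs (by linarith [Real.rpow_nonneg hc m]) (by positivity)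

lemma shiftRoot_le {m c s : ℝ} (hm : 1 ≤ m) (hc : 0 ≤ c) (hs : 0 ≤ s) :
    shiftRoot m c s ≤ s ^ (1 / m) + c := by
  have h0 : 0 ≤ s ^ (1 / m) := Real.rpow_nonneg hs _
  refine le_of_rpow_le_rpow hm (shiftRoot_nonneg hc hs) (by linarith) ?_
  have h := Real.add_rpow_le_rpow_add h0 hc hm
  rwa [rpow_inv_rpow' hm hs, ← shiftRoot_rpow hm hc hs] at h

section Discrete

variable {σ m X Y T a : ℝ} {f : ℝ → ℝ} {w : ℝ → ℝ → ℝ → ℝ} {D : Discretization}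
  {𝓡 : Set (ℝ → ℝ → ℝ → ℝ)}

/-- `Z` is discretely harmonic and vanishes at the lateral nodes. -/
structure IsDiscreteHarmonic (D : Discretization) (M : Mesh X Y T) (Z : ℕ → ℕ → ℝ) : Prop where
  interior : ∀ p, IsInteriorNode p → D M.I M.K (toGrid M.I M.K Z) p = 0
  lateral : ∀ i ≤ M.I, ∀ k ≤ M.K, (i = 0 ∨ i = M.I ∨ k = M.K) → Z i k = 0

/-- The comparison principle for affine functions of the exact solution, on the mesh `M`. -/
def AffineComparison (w : ℝ → ℝ → ℝ → ℝ) (D : Discretization) (a C : ℝ) (M : Mesh X Y T) : Prop :=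
  ∀ (Z : ℕ → ℕ → ℝ) (α β γ : ℝ), ∀ t ∈ Icc 0 T, IsDiscreteHarmonic D M Z → α ≤ 0 →
    (∀ i, 0 < i → i < M.I → γ * Z i 0 + α + β * w (M.x i) 0 t ≤ 0) →
    ∀ i ≤ M.I, ∀ k ≤ M.K,
      γ * Z i k + α + β * w (M.x i) (M.y k) t ≤ C * (|α| + |β|) * M.dx ^ a

/-- Transfer of the upper bound `(N + c) ^ m` from the base to all nodes. -/
lemma super_comparison (hm : 1 ≤ m) (hX : 0 < X) (hY : 0 < Y)
    (hw : IsClassicalSolution σ m X Y T f w) {S C : ℝ}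
    (hS : ∀ x ∈ Icc (-X) X, ∀ y ∈ Icc 0 Y, ∀ t ∈ Icc 0 T, w x y t ≤ S) (hC : 0 ≤ C)
    {M : Mesh X Y T} (hcmp : AffineComparison w D a C M) {Z : ℕ → ℕ → ℝ}
    (hZ : IsDiscreteHarmonic D M Z) {t c : ℝ} (ht : t ∈ Icc 0 T) (hc : 0 < c) (hc1 : c ≤ 1)
    (hbase : ∀ i, 0 < i → i < M.I → Z i 0 ≤ (shiftRoot m c (w (M.x i) 0 t) + c) ^ m) {i k : ℕ}
    (hi : i ≤ M.I) (hk : k ≤ M.K) :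
    Z i k ≤ (shiftRoot m c (w (M.x i) (M.y k) t) + c) ^ m
      + C * (((S ^ (1 / m) + 1) + 1) ^ m + 2 ^ (m - 1)) * M.dx ^ a := by
  have hda : 0 ≤ M.dx ^ a := Real.rpow_nonneg (M.dx_pos hX).le _
  have hx := M.x_mem hX hi
  have hy := M.y_mem hX hk
  have hs := hw.nonneg _ hx _ hy t ht
  obtain ⟨s, hsdef⟩ : ∃ s, s = w (M.x i) (M.y k) t := ⟨_, rfl⟩
  have hsS : s ≤ S := hsdef ▸ hS _ hx _ hy t ht
  rw [← hsdef] at hs ⊢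
  obtain ⟨z, hz⟩ : ∃ z, z = shiftRoot m c s := ⟨_, rfl⟩
  have hcz : c ≤ z := hz ▸ le_shiftRoot hm hc.le hs
  have hz0 : 0 < z := hc.trans_le hcz
  have hzm : z ^ m = s + c ^ m := hz ▸ shiftRoot_rpow hm hc.le hs
  have hzS : z ≤ S ^ (1 / m) + 1 := by
    have h1 : z ≤ s ^ (1 / m) + c := hz ▸ shiftRoot_le hm hc.le hs
    have h2 : s ^ (1 / m) ≤ S ^ (1 / m) := Real.rpow_le_rpow hs hsS (by positivity)
    linarith
  rw [← hz]
  -- The tangent is taken at the value s of w at the target node. On the base it dominates the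
  -- barrier, and at the target node it equals it.
  have htan : ∀ s' : ℝ, 0 ≤ s' → (shiftRoot m c s' + c) ^ m
      ≤ (z + c) ^ m + ((z + c) / z) ^ (m - 1) * (s' - s) := by
    intro s' hs'
    have h := add_rpow_le_tangent hm hc.le hz0 (shiftRoot_nonneg (m := m) hc.le hs')
    rw [shiftRoot_rpow hm hc.le hs', hzm] at h
    refine h.trans (le_of_eq ?_)
    ring
  obtain ⟨β, hβ⟩ : ∃ β, β = ((z + c) / z) ^ (m - 1) := ⟨_, rfl⟩
  rw [← hβ] at htan
  have hβ0 : 0 ≤ β := by rw [hβ]; positivity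
  -- Since c ≤ z, the slope stays bounded where w vanishes; this is the purpose of the shift by c^m.
  have hβ2 : β ≤ 2 ^ (m - 1) := by
    rw [hβ]
    refine Real.rpow_le_rpow (by positivity) ?_ (by linarith)
    rw [div_le_iff₀ hz0]
    linarith
  -- The tangent dominates a nonnegative function at 0, so its intercept has the sign that the
  -- comparison requires at the lateral nodes.
  have hα : 0 ≤ (z + c) ^ m - β * s := by
    have h1 := htan 0 le_rfl
    have h2 : 0 ≤ (shiftRoot m c 0 + c) ^ m :=
      Real.rpow_nonneg (add_nonneg (shiftRoot_nonneg hc.le le_rfl) hc.le) _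
    linarith
  have h := hcmp Z (-((z + c) ^ m - β * s)) (-β) 1 t ht hZ (by linarith) ?_ i hi k hk
  · rw [← hsdef, abs_neg, abs_neg, abs_of_nonneg hα, abs_of_nonneg hβ0] at h
    have h1 : (z + c) ^ m ≤ ((S ^ (1 / m) + 1) + 1) ^ m :=
      Real.rpow_le_rpow (by linarith) (by linarith) (by linarith)
    have h2 : 0 ≤ β * s := mul_nonneg hβ0 hs
    have h3 : C * ((z + c) ^ m - β * s + β) * M.dx ^ a
        ≤ C * (((S ^ (1 / m) + 1) + 1) ^ m + 2 ^ (m - 1)) * M.dx ^ a := by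
      gcongr
      linarith
    linarith
  · intro i' h1 h2
    have h3 := hbase i' h1 h2
    have h4 := htan _ (hw.nonneg _ (M.x_mem hX h2.le) 0 ⟨le_rfl, hY.le⟩ t ht)
    linarith

/-- Transfer of the lower bound `(u - c)₊ ^ m` from the base to all nodes. -/
lemma sub_comparison (hm : 1 ≤ m) (hX : 0 < X) (hY : 0 < Y)
    (hw : IsClassicalSolution σ m X Y T f w) {S C : ℝ}
    (hS : ∀ x ∈ Icc (-X) X, ∀ y ∈ Icc 0 Y, ∀ t ∈ Icc 0 T, w x y t ≤ S) (hS0 : 0 ≤ S) (hC : 0 ≤ C)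
    {M : Mesh X Y T} (hcmp : AffineComparison w D a C M) {Z : ℕ → ℕ → ℝ}
    (hZ : IsDiscreteHarmonic D M Z) {t c : ℝ} (ht : t ∈ Icc 0 T) (hc : 0 < c)
    (hbase : ∀ i, 0 < i → i < M.I → (max (w (M.x i) 0 t ^ (1 / m) - c) 0) ^ m ≤ Z i 0) {i k : ℕ}
    (hi : i ≤ M.I) (hk : k ≤ M.K) (hZ0 : 0 ≤ Z i k) :
    (max (w (M.x i) (M.y k) t ^ (1 / m) - c) 0) ^ m - C * (S + 1) * M.dx ^ a ≤ Z i k := by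
  have hda : 0 ≤ M.dx ^ a := Real.rpow_nonneg (M.dx_pos hX).le _
  have hx := M.x_mem hX hi
  have hy := M.y_mem hX hk
  have hs := hw.nonneg _ hx _ hy t ht
  obtain ⟨s, hsdef⟩ : ∃ s, s = w (M.x i) (M.y k) t := ⟨_, rfl⟩
  have hsS : s ≤ S := hsdef ▸ hS _ hx _ hy t ht
  rw [← hsdef] at hs ⊢
  obtain ⟨z, hz⟩ : ∃ z, z = s ^ (1 / m) := ⟨_, rfl⟩
  have hz0 : 0 ≤ z := hz ▸ Real.rpow_nonneg hs _
  have hzm : z ^ m = s := hz ▸ rpow_inv_rpow' hm hs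
  rw [← hz]
  rcases le_or_gt z c with hzc | hzc
  · rw [max_eq_right (by linarith), Real.zero_rpow (by linarith)]
    have : 0 ≤ C * (S + 1) * M.dx ^ a := by positivity
    linarith
  rw [max_eq_left (by linarith)]
  have htan : ∀ s' : ℝ, 0 ≤ s' → (z - c) ^ m + (1 - c / z) ^ (m - 1) * (s' - s)
      ≤ (max (s' ^ (1 / m) - c) 0) ^ m := by
    intro s' hs'
    have h := tangent_le_sub_rpow hm hc.le hzc (Real.rpow_nonneg hs' (1 / m))
    rwa [rpow_inv_rpow' hm hs', hzm] at h
  have hr : c / z ≤ 1 := (div_le_one (hc.trans hzc)).2 hzc.le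
  have hr0 : 0 ≤ c / z := by positivity
  obtain ⟨β, hβ⟩ : ∃ β, β = (1 - c / z) ^ (m - 1) := ⟨_, rfl⟩
  rw [← hβ] at htan
  have hβ0 : 0 ≤ β := by rw [hβ]; exact Real.rpow_nonneg (by linarith) _
  have hβ1 : β ≤ 1 := by rw [hβ]; exact Real.rpow_le_one (by linarith) (by linarith) (by linarith)
  -- Here the tangent lies below the convex barrier, which vanishes at 0; hence the intercept is
  -- nonpositive.
  have hα : (z - c) ^ m - β * s ≤ 0 := by
    have h1 := htan 0 le_rfl
    have e : max ((0 : ℝ) ^ (1 / m) - c) 0 = 0 := by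
      rw [Real.zero_rpow (by positivity)]
      exact max_eq_right (by linarith)
    rw [e, Real.zero_rpow (by linarith)] at h1
    linarith
  have h := hcmp Z ((z - c) ^ m - β * s) β (-1) t ht hZ hα ?_ i hi k hk
  · rw [← hsdef, abs_of_nonpos hα, abs_of_nonneg hβ0] at h
    have h1 : 0 ≤ (z - c) ^ m := Real.rpow_nonneg (by linarith) _
    have h2 : β * s ≤ 1 * S := by gcongr
    have h3 : C * (-((z - c) ^ m - β * s) + β) * M.dx ^ a ≤ C * (S + 1) * M.dx ^ a := by
      gcongr
      linarith
    linarith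
  · intro i' h1 h2
    have h3 := hbase i' h1 h2
    have h4 := htan _ (hw.nonneg _ (M.x_mem hX h2.le) 0 ⟨le_rfl, hY.le⟩ t ht)
    linarith

/-- Closeness on the base implies closeness at all nodes. -/
lemma abs_sub_le_of_base {C κ : ℝ} {M : Mesh X Y T} (hcmp : AffineComparison w D a C M)
    {Z : ℕ → ℕ → ℝ} (hZ : IsDiscreteHarmonic D M Z) {t : ℝ} (ht : t ∈ Icc 0 T) (hκ : 0 ≤ κ)
    (hbase : ∀ i, 0 < i → i < M.I → |w (M.x i) 0 t - Z i 0| ≤ κ) {i k : ℕ}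
    (hi : i ≤ M.I) (hk : k ≤ M.K) :
    |w (M.x i) (M.y k) t - Z i k| ≤ κ + C * (κ + 1) * M.dx ^ a := by
  have h1 := hcmp Z (-κ) (-1) 1 t ht hZ (by linarith)
    (fun i h1 h2 => by linarith [(abs_le.1 (hbase i h1 h2)).1]) i hi k hk
  have h2 := hcmp Z (-κ) 1 (-1) t ht hZ (by linarith)
    (fun i h1 h2 => by linarith [(abs_le.1 (hbase i h1 h2)).2]) i hi k hk
  rw [abs_neg, abs_of_nonneg hκ, abs_neg, abs_one] at h1
  rw [abs_neg, abs_of_nonneg hκ, abs_one] at h2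
  rw [abs_le]
  constructor <;> linarith

/-! ### Accumulation of the error -/

/-- The exact solution satisfies the one-step bounds with uniform constants. -/
lemma exists_exactStep (hw : IsClassicalSolution σ m X Y T f w)
    (hr : IsRegularSolution σ m X Y T w) (hσ0 : 0 < σ) (hσ2 : σ < 2) (hm : 1 ≤ m) (hX : 0 < X)
    (hY : 0 < Y) (hT : 0 < T) :
    ∃ Q Q₁ M₀ C : ℝ, 0 ≤ Q ∧ 0 ≤ Q₁ ∧ 0 ≤ M₀ ∧ 0 ≤ C ∧ ∀ (M : Mesh X Y T), ∀ j < M.J,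
      ∀ i, 0 < i → i < M.I → ExactStep m Q Q₁ M₀ C (nu σ * (M.dt / M.dx ^ σ)) M.dt
        (M.dx ^ (2 - σ)) (w (M.x i) 0 (M.t j) ^ (1 / m)) (w (M.x i) 0 (M.t (j + 1)) ^ (1 / m))
        (w (M.x i) (M.y 1) (M.t j)) (baseQ m T w (M.x i) (M.t j)) := by
  obtain ⟨Q, hQ, hrel⟩ := exists_baseQ_le_baseU hw hr hσ0 hσ2 hm hY hT
  obtain ⟨Q₁, hQ₁, hbd⟩ := exists_baseQ_bound hw hr hm hY hT
  obtain ⟨M₀, hM₀, htime⟩ := exists_time_bound hr hT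
  obtain ⟨C, hC, hflux⟩ := exists_flux_bound hw hr hσ0 hσ2 hY hT
  have hν := nu_pos hσ0 hσ2
  refine ⟨Q, Q₁, M₀, nu σ * C, hQ, hQ₁, hM₀, by positivity, fun M j hj i h1 h2 => ?_⟩
  have hx := M.x_mem_Ioo hX h1 h2
  have hx' := Ioo_subset_Icc_self hx
  have ht := M.t_mem hT hj.le
  have ht' := M.t_mem hT (j := j + 1) hj
  have hy0 : (0 : ℝ) ∈ Icc 0 Y := ⟨le_rfl, hY.le⟩
  have hw0 := hw.nonneg _ hx' 0 hy0 _ ht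
  have hdx := M.dx_pos hX
  have hdt := M.dt_pos hT
  refine ⟨Real.rpow_nonneg hw0 _, Real.rpow_nonneg (hw.nonneg _ hx' 0 hy0 _ ht') _,
    hw.nonneg _ hx' _ (M.y_mem hX M.K_pos) _ ht, ?_, ?_, hrel _ hx _ ht, hbd _ hx' _ ht⟩
  · have h := (htime _ hx').2 _ ht _ ht'
    have e : M.t (j + 1) - M.t j = M.dt := by rw [M.t_succ]; ring
    rwa [e] at h
  · have h := hflux _ hx _ (M.dx_mem hX) _ ht
    rw [rpow_inv_rpow' hm hw0, M.y_one]
    obtain ⟨q, hq⟩ : ∃ q, q = baseQ m T w (M.x i) (M.t j) := ⟨_, rfl⟩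
    rw [← hq] at h ⊢
    have hs : 0 < M.dx ^ σ := Real.rpow_pos_of_pos hdx σ
    have e1 : nu σ * (M.dt / M.dx ^ σ) * (w (M.x i) M.dx (M.t j) - w (M.x i) 0 (M.t j)) - M.dt * q
        = nu σ * (M.dt / M.dx ^ σ) * (w (M.x i) M.dx (M.t j) - w (M.x i) 0 (M.t j)
          - q / nu σ * M.dx ^ σ) := by
      field_simp
    have e2 : M.dx ^ 2 = M.dx ^ (2 - σ) * M.dx ^ σ := by
      rw [← Real.rpow_add hdx, sub_add_cancel]; norm_cast
    have hΛ : 0 ≤ nu σ * (M.dt / M.dx ^ σ) := by positivity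
    rw [e1, abs_mul, abs_of_nonneg hΛ]
    refine (mul_le_mul_of_nonneg_left h hΛ).trans (le_of_eq ?_)
    rw [e2]
    field_simp

set_option maxHeartbeats 800000 in
/-- The uniform `L^∞` bounds under the CFL condition with a positive bound `B` for `f`. -/
lemma exists_error_bound (hσ0 : 0 < σ) (hσ2 : σ < 2) (hm : 1 ≤ m) (hX : 0 < X) (hY : 0 < Y)
    (hT : 0 < T) (hw : IsClassicalSolution σ m X Y T f w) (hr : IsRegularSolution σ m X Y T w)
    (hmax : HasMaxPrinciple X Y T D) {δ C : ℝ} (hδ : 0 < δ) (hC : 0 ≤ C)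
    (hcmp : ∀ M : Mesh X Y T, M.dx ^ a ≤ δ → AffineComparison w D a C M)
    {B : ℝ} (hB : 0 < B) (hfB : ∀ x ∈ Icc (-X) X, 0 ≤ f x ∧ f x ≤ B) :
    ∃ C' : ℝ, ∀ (M : Mesh X Y T) (W : ℕ → ℕ → ℕ → ℝ),
      nu σ * (M.dt / M.dx ^ σ) * (m * B ^ (m - 1)) ≤ 1 → IsNumericalSolution σ m f D M W →
        ∀ j ≤ M.J, ∀ i ≤ M.I, ∀ k ≤ M.K, |w (M.x i) (M.y k) (M.t j) - W j i k|
          ≤ C' * (M.dt + M.dx ^ (2 - σ) + M.dx ^ a / M.dt) := by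
  obtain ⟨Q, Q₁, M₀, C₃, hQ, hQ₁, hM₀, hC₃, hexact⟩ :=
    exists_exactStep hw hr hσ0 hσ2 hm hX hY hT
  obtain ⟨S, hS0, hS⟩ := hw.exists_bound
  obtain ⟨A₁, hA₁, hsuper⟩ := exists_super_step (T := T) hm hQ hQ₁ hM₀ hC₃ hB
  obtain ⟨A₂, hA₂, hsub⟩ := exists_sub_step (Q₁ := Q₁) (B := B) hm hQ hM₀ hC₃
  have hν := nu_pos hσ0 hσ2
  have hmB : 0 < m * B ^ (m - 1) := mul_pos (by linarith) (Real.rpow_pos_of_pos hB _)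
  -- CFL gives Λ ≤ L on every admissible mesh, so the extension error contributes at most L times
  -- O(Δx^a) per step. This is where B > 0 is needed.
  obtain ⟨L, hL⟩ : ∃ L, L = 1 / (m * B ^ (m - 1)) := ⟨_, rfl⟩
  have hL0 : 0 ≤ L := by rw [hL]; positivity
  obtain ⟨C₄, hC₄⟩ : ∃ C₄, C₄ = C * (((S ^ (1 / m) + 1) + 1) ^ m + 2 ^ (m - 1)) := ⟨_, rfl⟩
  obtain ⟨C₅, hC₅⟩ : ∃ C₅, C₅ = C * (S + 1) := ⟨_, rfl⟩
  have hSm : 0 ≤ S ^ (1 / m) := Real.rpow_nonneg hS0 _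
  have hC₄0 : 0 ≤ C₄ := by rw [hC₄]; positivity
  have hC₅0 : 0 ≤ C₅ := by rw [hC₅]; positivity
  obtain ⟨A, hA⟩ : ∃ A, A = A₁ + A₂ + L * C₄ + L * C₅ := ⟨_, rfl⟩
  have hA0 : 0 ≤ A := by rw [hA]; positivity
  obtain ⟨E, hE⟩ : ∃ E, E = Real.exp (2 * A * T) := ⟨_, rfl⟩
  have hE0 : 0 < E := by rw [hE]; exact Real.exp_pos _
  obtain ⟨P, hP⟩ : ∃ P, P = m * (max (S ^ (1 / m)) B) ^ (m - 1) * 2 := ⟨_, rfl⟩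
  have hP0 : 0 ≤ P := by rw [hP]; positivity
  have hBm : 0 ≤ B ^ m := Real.rpow_nonneg hB.le m
  refine ⟨(S + B ^ m) * (T / δ + E) + (P * E + C * (P + 1) * T), ?_⟩
  intro M W hcfl hW j hj i hi k hk
  have hdx := M.dx_pos hX
  have hdt := M.dt_pos hT
  have hdtT := M.dt_le hT
  have hda : 0 ≤ M.dx ^ a := Real.rpow_nonneg hdx.le _
  have hτ : 0 ≤ M.dx ^ (2 - σ) := Real.rpow_nonneg hdx.le _
  obtain ⟨η, hη⟩ : ∃ η, η = M.dt + M.dx ^ (2 - σ) + M.dx ^ a / M.dt := ⟨_, rfl⟩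
  have hq0 : 0 ≤ M.dx ^ a / M.dt := by positivity
  have hη0 : 0 < η := by rw [hη]; positivity
  have hηa : M.dx ^ a ≤ T * η := by
    have h1 : M.dx ^ a / M.dt ≤ η := by rw [hη]; linarith
    rw [div_le_iff₀ hdt] at h1
    have h2 : η * M.dt ≤ η * T := by gcongr
    linarith
  obtain ⟨Λ, hΛ⟩ : ∃ Λ, Λ = nu σ * (M.dt / M.dx ^ σ) := ⟨_, rfl⟩
  have hΛ0 : 0 ≤ Λ := by
    rw [hΛ]
    have := Real.rpow_nonneg hdx.le σ
    positivity
  rw [← hΛ] at hcfl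
  rw [← hη]
  have hstab := hW.stable hmax hm hX hB.le hfB hΛ hΛ0 hcfl
  have hwb : ∀ {j i k}, j ≤ M.J → i ≤ M.I → k ≤ M.K →
      0 ≤ w (M.x i) (M.y k) (M.t j) ∧ w (M.x i) (M.y k) (M.t j) ≤ S := fun hj hi hk =>
    ⟨hw.nonneg _ (M.x_mem hX hi) _ (M.y_mem hX hk) _ (M.t_mem hT hj),
      hS _ (M.x_mem hX hi) _ (M.y_mem hX hk) _ (M.t_mem hT hj)⟩
  have hgood0 : 0 ≤ (P * E + C * (P + 1) * T) * η := by positivity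
  have hbad0 : 0 ≤ (S + B ^ m) * (T / δ + E) * η := by positivity
  -- the case in which the right-hand side is bounded below
  by_cases hsmall : M.dx ^ a ≤ δ ∧ η * E ≤ 1
  swap
  · have h1 : |w (M.x i) (M.y k) (M.t j) - W j i k| ≤ S + B ^ m := by
      obtain ⟨a1, a2⟩ := hwb hj hi hk
      obtain ⟨b1, b2⟩ := (hstab j hj).1 i hi k hk
      rw [abs_le]; constructor <;> linarith
    -- Either Δx^a > δ, and then T η ≥ Δx^a > δ, or η E > 1; in both cases the trivial bound S + B^m
    -- suffices.
    have h2 : 1 ≤ (T / δ + E) * η := by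
      by_contra hcon
      have p1 : 0 ≤ E * η := by positivity
      have p2 : 0 ≤ T / δ * η := by positivity
      rw [not_le, add_mul] at hcon
      refine hsmall ⟨?_, ?_⟩
      · have : T / δ * η ≤ 1 := by linarith
        rw [div_mul_eq_mul_div, div_le_one hδ] at this
        linarith
      · linarith
    have h3 : (S + B ^ m) * 1 ≤ (S + B ^ m) * ((T / δ + E) * η) := by gcongr
    linarith
  obtain ⟨hδM, hηE⟩ := hsmall
  have hcmpM := hcmp M hδM
  have hharm : ∀ j ≤ M.J, IsDiscreteHarmonic D M (W j) := fun j hj =>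
    ⟨hW.interior j hj, hW.lateral j hj⟩
  -- A discrete Grönwall sequence: it starts at the size η of the target error and grows by the
  -- factor 1 + 2AΔt per step.
  obtain ⟨c, hc⟩ : ∃ c : ℕ → ℝ, c = fun j => η * (1 + 2 * A * M.dt) ^ j := ⟨_, rfl⟩
  have hbase1 : 1 ≤ 1 + 2 * A * M.dt := by
    have : 0 ≤ 2 * A * M.dt := by positivity
    linarith
  have hcη : ∀ j, η ≤ c j := fun j => by
    rw [hc]
    exact le_mul_of_one_le_right hη0.le (one_le_pow₀ hbase1)
  have hcE : ∀ j ≤ M.J, c j ≤ η * E := by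
    intro j hj
    rw [hc, hE]
    have h1 : 1 + 2 * A * M.dt ≤ Real.exp (2 * A * M.dt) := by
      linarith [Real.add_one_le_exp (2 * A * M.dt)]
    have h2 : (1 + 2 * A * M.dt) ^ j ≤ Real.exp (2 * A * M.dt) ^ j :=
      pow_le_pow_left₀ (by linarith) h1 j
    rw [← Real.exp_nat_mul] at h2
    have h3 : (j : ℝ) * (2 * A * M.dt) ≤ 2 * A * T := by
      have h4 : (j : ℝ) * M.dt ≤ T := (M.t_mem hT hj).2
      calc (j : ℝ) * (2 * A * M.dt) = 2 * A * ((j : ℝ) * M.dt) := by ring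
        _ ≤ 2 * A * T := by gcongr
    exact mul_le_mul_of_nonneg_left (h2.trans (Real.exp_le_exp.2 h3)) hη0.le
  have hc0 : ∀ j, 0 < c j := fun j => hη0.trans_le (hcη j)
  have hc1 : ∀ j ≤ M.J, c j ≤ 1 := fun j hj => (hcE j hj).trans hηE
  have hcs : ∀ j, c (j + 1) - c j = 2 * A * M.dt * c j := by
    intro j; rw [hc]; simp only [pow_succ]; ring
  have hΛL : Λ ≤ L := by rw [hL, le_div_iff₀ hmB]; exact hcfl
  -- Since c_j ≥ η, both Δt + Δx^(2-σ) ≤ c_j and Δx^a ≤ c_j Δt hold; the second is why Δx^a/Δt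
  -- enters η. All losses are then at most 2AΔt c_j.
  have hinc : ∀ {A' C' : ℝ}, 0 ≤ A' → 0 ≤ C' → A' + L * C' ≤ A → ∀ j,
      A' * M.dt * (c j + M.dt + M.dx ^ (2 - σ)) + Λ * (C' * M.dx ^ a) ≤ c (j + 1) - c j := by
    intro A' C' hA' hC' hAA j
    have h1 : M.dt + M.dx ^ (2 - σ) ≤ c j := le_trans (by rw [hη]; linarith) (hcη j)
    have h2 : M.dx ^ a ≤ c j * M.dt := by
      rw [← div_le_iff₀ hdt]; exact le_trans (by rw [hη]; linarith) (hcη j)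
    have hcj := hc0 j
    have h3 : A' * M.dt * (c j + M.dt + M.dx ^ (2 - σ)) ≤ A' * M.dt * (2 * c j) := by
      gcongr; linarith
    have h4 : Λ * (C' * M.dx ^ a) ≤ L * (C' * (c j * M.dt)) := by gcongr
    have h5 : 0 ≤ L * (C' * (c j * M.dt)) := by positivity
    have h6 := mul_le_mul_of_nonneg_right hAA (by positivity : 0 ≤ 2 * (c j * M.dt))
    rw [hcs]
    linarith
  -- barriers on the base
  have hmain : ∀ j ≤ M.J, ∀ i, 0 < i → i < M.I →
      W j i 0 ^ (1 / m) ≤ shiftRoot m (c j) (w (M.x i) 0 (M.t j)) + c j ∧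
      max (w (M.x i) 0 (M.t j) ^ (1 / m) - c j) 0 ≤ W j i 0 ^ (1 / m) := by
    intro j
    induction j with
    | zero =>
      intro hj i h1 h2
      have e : W 0 i 0 = w (M.x i) 0 (M.t 0) := by
        rw [hW.init i h1 h2, M.t_zero, hw.initial _ (M.x_mem hX h2.le)]
      have h3 := (hwb hj h2.le (Nat.zero_le M.K)).1
      rw [M.y_zero] at h3
      rw [e]
      refine ⟨?_, max_le (by linarith [hc0 0]) (Real.rpow_nonneg h3 _)⟩
      linarith [root_le_shiftRoot hm (hc0 0).le h3, hc0 0]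
    | succ j ih =>
      intro hj i h1 h2
      have hjJ : j < M.J := hj
      have ih := ih hjJ.le
      have hx := hexact M j hjJ i h1 h2
      rw [← hΛ] at hx
      obtain ⟨a1, a2⟩ := (hstab j hjJ.le).1 i h2.le 0 (Nat.zero_le _)
      obtain ⟨d1, d2⟩ := (hstab j hjJ.le).2 hjJ i h1 h2
      have hU0 : 0 ≤ W j i 0 ^ (1 / m) := Real.rpow_nonneg a1 _
      have hUB : W j i 0 ^ (1 / m) ≤ B := by
        have := Real.rpow_le_rpow a1 a2 (by positivity : 0 ≤ 1 / m)
        rwa [rpow_rpow_inv' hm hB.le] at this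
      have hU' : W (j + 1) i 0 ^ (1 / m) = Λ * (W j i 1 - W j i 0) + W j i 0 ^ (1 / m) := by
        rw [hW.step j hjJ i h1 h2, ← hΛ, rpow_rpow_inv' hm d1]
      have hU'' : W (j + 1) i 0 ^ (1 / m)
          = W j i 0 ^ (1 / m) + Λ * (W j i 1 - (W j i 0 ^ (1 / m)) ^ m) := by
        rw [hU', rpow_inv_rpow' hm a1]; ring
      have ht := M.t_mem hT hjJ.le
      have hroot : ∀ {j i}, j ≤ M.J → i ≤ M.I → 0 ≤ w (M.x i) 0 (M.t j) := by
        intro j i hj hi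
        have := (hwb hj hi (Nat.zero_le M.K)).1
        rwa [M.y_zero] at this
      have hup := super_comparison hm hX hY hw hS hC hcmpM (hharm j hjJ.le) ht (hc0 j)
        (hc1 j hjJ.le) (fun i' h1' h2' => by
          have h3 := (ih i' h1' h2').1
          have h4 := ((hstab j hjJ.le).1 i' h2'.le 0 (Nat.zero_le _)).1
          have h5 := Real.rpow_le_rpow (Real.rpow_nonneg h4 _) h3 (by linarith : 0 ≤ m)
          rwa [rpow_inv_rpow' hm h4] at h5) h2.le M.K_pos
      have hlow := sub_comparison hm hX hY hw hS hS0 hC hcmpM (hharm j hjJ.le) ht (hc0 j)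
        (fun i' h1' h2' => by
          have h3 := (ih i' h1' h2').2
          have h4 := ((hstab j hjJ.le).1 i' h2'.le 0 (Nat.zero_le _)).1
          have h5 := Real.rpow_le_rpow (le_max_right _ _) h3 (by linarith : 0 ≤ m)
          rwa [rpow_inv_rpow' hm h4] at h5) h2.le M.K_pos
        ((hstab j hjJ.le).1 i h2.le 1 M.K_pos).1
      rw [← hC₄] at hup
      rw [← hC₅] at hlow
      have hw0 := hroot hjJ.le h2.le
      have hw0' := hroot hj h2.le
      have hcc : c j ≤ c (j + 1) := by
        have := hcs j
        have := hc0 j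
        have : 0 ≤ 2 * A * M.dt * c j := by positivity
        linarith
      refine ⟨?_, max_le ?_ (hU' ▸ d1)⟩
      · refine hsuper hx hΛ0 hcfl hdt hdtT hτ hU0 hUB (hU' ▸ d2) hU'' (hc0 j) hcc
          (shiftRoot_nonneg (hc0 j).le hw0) (shiftRoot_nonneg (hc0 j).le hx.w₁_nonneg)
          (shiftRoot_nonneg (hc0 (j + 1)).le hw0') ?_ (shiftRoot_rpow hm (hc0 j).le hx.w₁_nonneg)
          ?_ (ih i h1 h2).1 hup (hinc hA₁ hC₄0 ?_ j)
        · rw [rpow_inv_rpow' hm hw0]; exact shiftRoot_rpow hm (hc0 j).le hw0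
        · rw [rpow_inv_rpow' hm hw0']; exact shiftRoot_rpow hm (hc0 (j + 1)).le hw0'
        · rw [hA]
          have : 0 ≤ L * C₅ := by positivity
          linarith
      · refine hsub hx hΛ0 hcfl hdt hτ hUB hU'' (hc0 j) (Real.rpow_nonneg hx.w₁_nonneg (1 / m))
          (rpow_inv_rpow' hm hx.w₁_nonneg) (ih i h1 h2).2 hlow (hinc hA₂ hC₅0 ?_ j)
        rw [hA]
        have : 0 ≤ L * C₄ := by positivity
        linarith
  -- conclusion
  have hcj0 := hc0 j
  have hfin : ∀ i, 0 < i → i < M.I → |w (M.x i) 0 (M.t j) - W j i 0| ≤ P * c j := by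
    intro i h1 h2
    obtain ⟨b1, b2⟩ := hmain j hj i h1 h2
    obtain ⟨a1, a2⟩ := (hstab j hj).1 i h2.le 0 (Nat.zero_le _)
    obtain ⟨w1, w2⟩ := hwb hj h2.le (Nat.zero_le M.K)
    rw [M.y_zero] at w1 w2
    have hUB : W j i 0 ^ (1 / m) ≤ B := by
      have := Real.rpow_le_rpow a1 a2 (by positivity : 0 ≤ 1 / m)
      rwa [rpow_rpow_inv' hm hB.le] at this
    have huS : w (M.x i) 0 (M.t j) ^ (1 / m) ≤ S ^ (1 / m) :=
      Real.rpow_le_rpow w1 w2 (by positivity)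
    have h3 := abs_rpow_sub_rpow_le_of_le hm (Real.rpow_nonneg w1 (1 / m))
      (Real.rpow_nonneg a1 (1 / m)) (huS.trans (le_max_left _ B)) (hUB.trans (le_max_right _ B))
    rw [rpow_inv_rpow' hm w1, rpow_inv_rpow' hm a1] at h3
    have h4 : |w (M.x i) 0 (M.t j) ^ (1 / m) - W j i 0 ^ (1 / m)| ≤ 2 * c j := by
      have h5 := shiftRoot_le hm hcj0.le w1
      have h6 := (le_max_left _ _).trans b2
      rw [abs_le]; constructor <;> linarith
    refine h3.trans ?_
    rw [hP, mul_assoc _ 2 (c j)]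
    gcongr
  have h := abs_sub_le_of_base hcmpM (hharm j hj) (M.t_mem hT hj) (by positivity) hfin hi hk
  have h1 : P * c j ≤ P * (η * E) := mul_le_mul_of_nonneg_left (hcE j hj) hP0
  have h2 : P * c j ≤ P * 1 := mul_le_mul_of_nonneg_left (hc1 j hj) hP0
  have h3 : C * (P * c j + 1) * M.dx ^ a ≤ C * (P + 1) * (T * η) := by
    gcongr
    linarith
  linarith

/-- If `f` vanishes and `m > 1`, the error is of order `Δx ^ a`. -/
lemma exists_error_bound_of_zero (hσ0 : 0 < σ) (hσ2 : σ < 2) (hm : 1 < m) (hX : 0 < X)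
    (hY : 0 < Y) (hT : 0 < T) (hw : IsClassicalSolution σ m X Y T f w)
    (hr : IsRegularSolution σ m X Y T w) (hmax : HasMaxPrinciple X Y T D) {δ C : ℝ} (hδ : 0 < δ)
    (hC : 0 ≤ C) (hcmp : ∀ M : Mesh X Y T, M.dx ^ a ≤ δ → AffineComparison w D a C M)
    (hf : ∀ x ∈ Icc (-X) X, f x = 0) :
    ∃ C' : ℝ, ∀ (M : Mesh X Y T) (W : ℕ → ℕ → ℕ → ℝ), IsNumericalSolution σ m f D M W →
        ∀ j ≤ M.J, ∀ i ≤ M.I, ∀ k ≤ M.K, |w (M.x i) (M.y k) (M.t j) - W j i k|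
          ≤ C' * (M.dt + M.dx ^ (2 - σ) + M.dx ^ a / M.dt) := by
  obtain ⟨S, hS0, hS⟩ := hw.exists_bound
  obtain ⟨Q, hQ, hrel⟩ := exists_baseQ_le_baseU hw hr hσ0 hσ2 hm.le hY hT
  have hm1 : 0 < m - 1 := by linarith
  have hν := nu_pos hσ0 hσ2
  -- Grönwall's lemma for |∂ₜu| ≤ Q/(m-1) u with u = 0 at t = 0.
  have hzero : ∀ x ∈ Ioo (-X) X, ∀ t ∈ Icc 0 T, w x 0 t = 0 := by
    intro x hx t ht
    have hx' := Ioo_subset_Icc_self hx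
    have hw0 : ∀ s ∈ Icc 0 T, 0 ≤ w x 0 s := fun s hs => hw.nonneg x hx' 0 ⟨le_rfl, hY.le⟩ s hs
    have h := eq_zero_of_abs_deriv_le_mul_abs_self_of_eq_zero_right (K := Q / (m - 1))
      (f := fun s => baseU m w x s) (f' := fun s => baseQ m T w x s)
      (hw.continuousOn_baseU hm.le hY hx') ?_ ?_ ?_ t ht
    · have h1 := rpow_inv_rpow' hm.le (hw0 t ht)
      have h2 : w x 0 t ^ (1 / m) = 0 := h
      rw [h2, Real.zero_rpow (by linarith)] at h1
      exact h1.symm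
    · intro s hs
      have h1 := (((hr.time x hx').differentiableOn (by norm_num)) s
        ⟨hs.1, hs.2.le⟩).hasDerivWithinAt
      exact h1.mono_of_mem_nhdsWithin (Icc_mem_nhdsGE_of_mem hs)
    · show w x 0 0 ^ (1 / m) = 0
      rw [hw.initial x hx', hf x hx', Real.zero_rpow (by linarith), Real.zero_rpow (by positivity)]
    · intro s hs
      have h1 := hrel x hx s ⟨hs.1, hs.2.le⟩
      rw [Real.norm_eq_abs, Real.norm_eq_abs,
        abs_of_nonneg (Real.rpow_nonneg (hw0 s ⟨hs.1, hs.2.le⟩) _), div_mul_eq_mul_div,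
        le_div_iff₀ hm1]
      linarith
  refine ⟨S * (T / δ) + C * T, ?_⟩
  intro M W hW j hj i hi k hk
  have hdx := M.dx_pos hX
  have hdt := M.dt_pos hT
  have hdtT := M.dt_le hT
  have hda : 0 ≤ M.dx ^ a := Real.rpow_nonneg hdx.le _
  have hτ : 0 ≤ M.dx ^ (2 - σ) := Real.rpow_nonneg hdx.le _
  have hσp : 0 ≤ M.dx ^ σ := Real.rpow_nonneg hdx.le _
  have hηa : M.dx ^ a ≤ T * (M.dt + M.dx ^ (2 - σ) + M.dx ^ a / M.dt) := by
    calc M.dx ^ a = M.dt * (M.dx ^ a / M.dt) := by field_simp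
      _ ≤ T * (M.dt + M.dx ^ (2 - σ) + M.dx ^ a / M.dt) := by
        gcongr
        linarith
  obtain ⟨η, hη⟩ : ∃ η, η = M.dt + M.dx ^ (2 - σ) + M.dx ^ a / M.dt := ⟨_, rfl⟩
  rw [← hη] at hηa ⊢
  have hη0 : 0 ≤ η := by rw [hη]; positivity
  -- Stability with B = 0: since 0^(m-1) = 0 for m > 1, its step restriction holds for every Λ, and
  -- it forces W = 0.
  have hstab := hW.stable hmax hm.le hX le_rfl (fun x hx => by rw [hf x hx]; simp) rfl
    (by positivity) (by rw [Real.zero_rpow hm1.ne']; simp)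
  have hWz : ∀ i ≤ M.I, ∀ k ≤ M.K, W j i k = 0 := by
    intro i hi k hk
    obtain ⟨h1, h2⟩ := (hstab j hj).1 i hi k hk
    rw [Real.zero_rpow (by linarith)] at h2
    linarith
  have ht := M.t_mem hT hj
  by_cases hδM : M.dx ^ a ≤ δ
  · have h := abs_sub_le_of_base (hcmp M hδM) ⟨hW.interior j hj, hW.lateral j hj⟩ ht le_rfl
      (fun i h1 h2 => by
        rw [hzero _ (M.x_mem_Ioo hX h1 h2) _ ht, hWz i h2.le 0 (Nat.zero_le _)]; simp) hi hk
    have h1 : C * M.dx ^ a ≤ C * (T * η) := by gcongr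
    have h2 : 0 ≤ S * (T / δ) * η := by positivity
    linarith
  · rw [hWz i hi k hk, sub_zero, abs_of_nonneg (hw.nonneg _ (M.x_mem hX hi) _ (M.y_mem hX hk) _ ht)]
    have h1 := hS _ (M.x_mem hX hi) _ (M.y_mem hX hk) _ ht
    have h2 : 1 ≤ T / δ * η := by
      rw [div_mul_eq_mul_div, one_le_div hδ]; linarith
    have h3 : S * 1 ≤ S * (T / δ * η) := by gcongr
    have h4 : 0 ≤ C * T * η := by positivity
    linarith

/-- The error estimate at all nodes. -/
lemma exists_nodal_error_bound (hσ0 : 0 < σ) (hσ2 : σ < 2) (hm : 1 ≤ m) (hX : 0 < X) (hY : 0 < Y)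
    (hT : 0 < T) (hf : ∀ x ∈ Icc (-X) X, 0 ≤ f x) (hw : IsClassicalSolution σ m X Y T f w)
    (hr : IsRegularSolution σ m X Y T w)
    (hsm : ∀ v : ℝ → ℝ → ℝ,
      ContDiff ℝ ∞ (fun p : ℝ × ℝ => v p.1 p.2) → (fun x y _ => v x y) ∈ 𝓡)
    (hw𝓡 : w ∈ 𝓡) (hD : HasOrder σ X Y T D a 𝓡) (hmax : HasMaxPrinciple X Y T D) :
    ∃ C : ℝ, ∀ (M : Mesh X Y T) (W : ℕ → ℕ → ℕ → ℝ),
      CFL σ m f M → IsNumericalSolution σ m f D M W →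
        ∀ j ≤ M.J, ∀ i ≤ M.I, ∀ k ≤ M.K, |w (M.x i) (M.y k) (M.t j) - W j i k|
          ≤ C * (M.dt + M.dx ^ (2 - σ) + M.dx ^ a / M.dt) := by
  obtain ⟨δ, hδ, C, hC, hcmp'⟩ := exists_affine_comparison hσ0 hX hY hT hw hsm hw𝓡 hD hmax
  have hcmp : ∀ M : Mesh X Y T, M.dx ^ a ≤ δ → AffineComparison w D a C M :=
    fun M hM Z α β γ t ht hZ => hcmp' M hM Z α β γ t ht hZ.interior hZ.lateral
  obtain ⟨S, hS0, hS⟩ := hw.exists_bound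
  -- Boundedness of f comes from f^m = w(·,0,0); without it the supremum would take a default value.
  have hbdd : BddAbove (f '' Icc (-X) X) := by
    refine ⟨S ^ (1 / m), ?_⟩
    rintro _ ⟨x, hx, rfl⟩
    have h1 := hS x hx 0 ⟨le_rfl, hY.le⟩ 0 ⟨le_rfl, hT.le⟩
    rw [hw.initial x hx] at h1
    have h2 := Real.rpow_le_rpow (Real.rpow_nonneg (hf x hx) m) h1 (by positivity : 0 ≤ 1 / m)
    rwa [rpow_rpow_inv' hm (hf x hx)] at h2
  have hfB : ∀ x ∈ Icc (-X) X, f x ≤ supNorm X f := fun x hx =>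
    le_csSup hbdd ⟨x, hx, rfl⟩
  have h0X : (0 : ℝ) ∈ Icc (-X) X := ⟨by linarith, hX.le⟩
  have hB0 : 0 ≤ supNorm X f := (hf 0 h0X).trans (hfB 0 h0X)
  have hcfl : ∀ M : Mesh X Y T, CFL σ m f M →
      nu σ * (M.dt / M.dx ^ σ) * (m * supNorm X f ^ (m - 1)) ≤ 1 := by
    intro M hM
    have hs : 0 < M.dx ^ σ := Real.rpow_pos_of_pos (M.dx_pos hX) σ
    unfold CFL at hM
    calc nu σ * (M.dt / M.dx ^ σ) * (m * supNorm X f ^ (m - 1))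
        = m * supNorm X f ^ (m - 1) * nu σ * M.dt / M.dx ^ σ := by ring
      _ ≤ 1 := (div_le_one hs).2 hM
  -- For m = 1 the CFL condition does not involve the bound on f, since its power is 0, so the bound
  -- may be raised to a positive one. For m > 1 only f = 0 escapes the general argument.
  rcases hm.eq_or_lt with hm1 | hm1
  · obtain ⟨C', hC'⟩ := exists_error_bound hσ0 hσ2 hm hX hY hT hw hr hmax hδ hC hcmp
      (B := supNorm X f + 1) (by linarith) fun x hx => ⟨hf x hx, by linarith [hfB x hx]⟩
    refine ⟨C', fun M W hM => hC' M W ?_⟩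
    have h := hcfl M hM
    have e : m - 1 = 0 := by linarith
    rw [e, Real.rpow_zero] at h ⊢
    exact h
  rcases hB0.eq_or_lt with hB | hB
  · obtain ⟨C', hC'⟩ := exists_error_bound_of_zero hσ0 hσ2 hm1 hX hY hT hw hr hmax hδ hC hcmp
      fun x hx => le_antisymm (hB ▸ hfB x hx) (hf x hx)
    exact ⟨C', fun M W _ => hC' M W⟩
  · obtain ⟨C', hC'⟩ := exists_error_bound hσ0 hσ2 hm hX hY hT hw hr hmax hδ hC hcmp
      hB fun x hx => ⟨hf x hx, hfB x hx⟩
    exact ⟨C', fun M W hM => hC' M W (hcfl M hM)⟩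

end Discrete

/-! ### From nodal bounds to the maximal error -/

lemma errF_nonneg {X Y T : ℝ} (w : ℝ → ℝ → ℝ → ℝ) (M : Mesh X Y T) (W : ℕ → ℕ → ℕ → ℝ) (j : ℕ) :
    0 ≤ errF w M W j := by
  unfold errF
  rw [Finset.le_sup'_iff]
  exact ⟨(0, 0), Finset.mem_univ _, abs_nonneg _⟩

lemma maxErr_nonneg {X Y T : ℝ} (w : ℝ → ℝ → ℝ → ℝ) (M : Mesh X Y T) (W : ℕ → ℕ → ℕ → ℝ) :
    0 ≤ maxErr w M W := by
  unfold maxErr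
  rw [Finset.le_sup'_iff]
  exact ⟨0, Finset.mem_range.2 (Nat.succ_pos _), errF_nonneg w M W 0⟩

end FracPME

theorem mainTheorem5 (σ m X Y T a : ℝ) (hσ0 : 0 < σ) (hσ2 : σ < 2) (hm : 1 ≤ m)
    (hX : 0 < X) (hY : 0 < Y) (hT : 0 < T)
    (f : ℝ → ℝ) (hf : ∀ x ∈ Set.Icc (-X) X, 0 ≤ f x)
    (w : ℝ → ℝ → ℝ → ℝ)
    (hw : FracPME.IsClassicalSolution σ m X Y T f w)
    (hreg : FracPME.IsRegularSolution σ m X Y T w)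
    -- the class of "regular enough" functions contains the smooth ones and the exact solution
    (𝓡 : Set (ℝ → ℝ → ℝ → ℝ))
    (h𝓡smooth : ∀ v : ℝ → ℝ → ℝ,
      ContDiff ℝ ∞ (fun p : ℝ × ℝ => v p.1 p.2) → (fun x y _ => v x y) ∈ 𝓡)
    (h𝓡w : w ∈ 𝓡)
    (D : FracPME.Discretization)
    (hDorder : FracPME.HasOrder σ X Y T D a 𝓡)
    (hDmax : FracPME.HasMaxPrinciple X Y T D) :
    (∃ C : ℝ, ∀ (M : FracPME.Mesh X Y T) (W : ℕ → ℕ → ℕ → ℝ),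
      FracPME.CFL σ m f M → FracPME.IsNumericalSolution σ m f D M W →
        ∀ j ≤ M.J, FracPME.errF w M W j ≤ C * (M.dt + M.dx ^ (2 - σ) + M.dx ^ a / M.dt)) ∧
    (∀ (M : ℕ → FracPME.Mesh X Y T) (W : ℕ → ℕ → ℕ → ℕ → ℝ),
      (∀ n, FracPME.CFL σ m f (M n)) →
      (∀ n, FracPME.IsNumericalSolution σ m f D (M n) (W n)) →
      Filter.Tendsto (fun n => (M n).dx) Filter.atTop (nhds 0) →
      Filter.Tendsto (fun n => (M n).dt) Filter.atTop (nhds 0) →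
      Filter.Tendsto (fun n => (M n).dx ^ a / (M n).dt) Filter.atTop (nhds 0) →
        Filter.Tendsto (fun n => FracPME.maxErr w (M n) (W n)) Filter.atTop (nhds 0)) := by
  obtain ⟨C, hC⟩ := FracPME.exists_nodal_error_bound hσ0 hσ2 hm hX hY hT hf hw hreg h𝓡smooth h𝓡w
    hDorder hDmax
  have herr : ∀ (M : FracPME.Mesh X Y T) (W : ℕ → ℕ → ℕ → ℝ),
      FracPME.CFL σ m f M → FracPME.IsNumericalSolution σ m f D M W →
        ∀ j ≤ M.J, FracPME.errF w M W j ≤ C * (M.dt + M.dx ^ (2 - σ) + M.dx ^ a / M.dt) :=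
    fun M W hM hW j hj => Finset.sup'_le _ _ fun p _ => hC M W hM hW j hj _
      (Nat.lt_succ_iff.1 p.1.is_lt) _ (Nat.lt_succ_iff.1 p.2.is_lt)
  refine ⟨⟨C, herr⟩, fun M W hM hW hdx hdt hda => ?_⟩
  have hτ : Tendsto (fun n => (M n).dx ^ (2 - σ)) atTop (𝓝 0) := by
    have h := hdx.rpow_const (p := 2 - σ) (Or.inr (by linarith))
    rwa [Real.zero_rpow (by linarith)] at h
  have hlim := ((hdt.add hτ).add hda).const_mul C
  rw [add_zero, add_zero, mul_zero] at hlim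
  refine squeeze_zero (fun n => ?_) (fun n => ?_) hlim
  · exact FracPME.maxErr_nonneg w (M n) (W n)
  · exact Finset.sup'_le _ _ fun j hj =>
      herr (M n) (W n) (hM n) (hW n) j (Nat.lt_succ_iff.1 (Finset.mem_range.1 hj))
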